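/- Theorem 3 (Quadrisection theorem for triangles). A quadrisection of a (nondegenerate) triangle $T$ in the Euclidean plane is an unordered pair of perpendicular segments, with endpoints on the boundary of $T$, which divide $T$ into exactly four regions, each of area $\tfrac14\,\mathrm{area}(T)$. For $x\in[\sqrt2/2,1]$ put $$y(x)=2-2x+\tfrac12\sqrt{12x^2-16x+6},\quad c(x)=x^2-y(x)^2+\tfrac12,\quad r(x)=x^2+y(x)^2-\tfrac12,\quad \theta(x)=\arccos\frac{1/2-c(x)}{r(x)},$$ let $D=\{(x,\theta): \sqrt2/2\le x\le 1,\ 0\le\theta\le\theta(x)\}$ and let $F:D\to\mathbb R^2$, $F(x,\theta)=(c(x)+r(x)\cos\theta,\ r(x)\sin\theta)$. Let $J_0\subset D$ be the curve on which the Jacobian determinant $c'(x)r(x)\cos\theta+r'(x)r(x)$ of $F$ vanishes, let $U$ be the connected component of $D\setminus J_0$ that contains $(\sqrt2/2,0)$, let $V=(D\setminus J_0)\setminus U$, and let $D_2=V\cup J_0$. Let $I_1=F\bigl(1,\arccos(-r'(1)/c'(1))\bigr)$, the endpoint of the envelope $F(J_0)$ that comes from $x=1$. Let $T$ be a triangle.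 There is a unique point $C=(h,t)$ with $h\ge\tfrac12$, $t>0$, $h^2+t^2\ge1$ and $(h-1)^2+t^2\le1$ such that $T$ is similar to the triangle with vertices $(0,0)$, $(1,0)$, $C$ (so the side from $(0,0)$ to $(1,0)$ is a side of middle length). Let $C'$ be the inverse of $C$ about the unit circle with center $(1,0)$. 1. If $C'\in F(D_2)\setminus F(J_0)$, then $T$ has exactly $3$ quadrisections. 2. If $C'\in F(J_0)$ and $C'\ne I_1$, then $T$ has exactly $2$ quadrisections. 3. Otherwise (that is, if $C'\notin F(D_2)$ or $C'=I_1$), $T$ has exactly $1$ quadrisection. -/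

import Mathlib

open Real Set MeasureTheory

noncomputable section

namespace Quadrisection

/-- The Euclidean plane. -/
abbrev Plane := EuclideanSpace ℝ (Fin 2)

/-- The closed region bounded by a triangle. -/
def body (T : Affine.Triangle ℝ Plane) : Set Plane := convexHull ℝ (Set.range T.points)

/-- The regions into which the two segments `s` and `t` divide `T`: the connected components of
`T` with `s` and `t` removed. -/
def regions (T : Affine.Triangle ℝ Plane) (s t : Set Plane) : Set (Set Plane) :=
  {K | ∃ z ∈ body T \ (s ∪ t), K = connectedComponentIn (body T \ (s ∪ t)) z}

/-- `s` and `t` are perpendicular segments, with endpoints on the boundary of `T`, which divide `T`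
into exactly four regions, each having one fourth of the area of `T`. -/
def IsQuadrisection (T : Affine.Triangle ℝ Plane) (s t : Set Plane) : Prop :=
  (∃ P ∈ frontier (body T), ∃ X ∈ frontier (body T),
    ∃ Q ∈ frontier (body T), ∃ Y ∈ frontier (body T),
      P ≠ X ∧ Q ≠ Y ∧ s = segment ℝ X P ∧ t = segment ℝ Y Q ∧ inner ℝ (P - X) (Q - Y) = 0) ∧
  (regions T s t).encard = 4 ∧
  ∀ K ∈ regions T s t, volume K = volume (body T) / 4

/-- The number of quadrisections of `T`. A quadrisection is an unordered pair of segments. -/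
def quads (T : Affine.Triangle ℝ Plane) : ℕ∞ :=
  {q : Sym2 (Set Plane) | ∃ s t : Set Plane, q = s(s, t) ∧ IsQuadrisection T s t}.encard

/-- The triangle `T` is similar (for some matching of the vertices, reflections allowed) to the
triangle with vertices `(0,0)`, `(1,0)` and `C`. -/
def HasShape (T : Affine.Triangle ℝ Plane) (C : Plane) : Prop :=
  ∃ σ : Equiv.Perm (Fin 3), Similar (T.points ∘ σ) ![!₂[0, 0], !₂[1, 0], C]

/-- The points `C = (h, ht)` with `h ≥ 1/2`, `ht > 0` such that the side from `A = (0,0)` to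
`B = (1,0)` is the middle leg of the triangle `ABC` (ties allowed): `|BC| ≤ |AB| ≤ |AC|`. -/
def middleRegion : Set Plane :=
  {C | 1 / 2 ≤ C 0 ∧ 0 < C 1 ∧ 1 ≤ C 0 ^ 2 + C 1 ^ 2 ∧ (C 0 - 1) ^ 2 + C 1 ^ 2 ≤ 1}

/-- `y(x)`, the relevant solution of the area equation. -/
def yOf (x : ℝ) : ℝ := 2 - 2 * x + √(12 * x ^ 2 - 16 * x + 6) / 2

/-- `c(x)`: the circle of parameter `x` has center `(c(x), 0)`. -/
def cen (x : ℝ) : ℝ := x ^ 2 - yOf x ^ 2 + 1 / 2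

/-- `r(x)`: the radius of the circle of parameter `x`. -/
def rad (x : ℝ) : ℝ := x ^ 2 + yOf x ^ 2 - 1 / 2

/-- `θ(x)`: the angle at which the circle of parameter `x` meets the line `h = 1/2`. -/
def thetaMax (x : ℝ) : ℝ := arccos ((1 / 2 - cen x) / rad x)

/-- The domain `D`, a set of pairs `(x, θ)`. -/
def D : Set (ℝ × ℝ) := {q | q.1 ∈ Icc (√2 / 2) 1 ∧ q.2 ∈ Icc 0 (thetaMax q.1)}

/-- The map `F`. -/
def F (q : ℝ × ℝ) : Plane :=
  !₂[cen q.1 + rad q.1 * cos q.2, rad q.1 * sin q.2]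

/-- The Jacobian determinant of `F`. -/
def jacF (q : ℝ × ℝ) : ℝ :=
  deriv cen q.1 * rad q.1 * cos q.2 + deriv rad q.1 * rad q.1

/-- The curve `J₀` in `D` on which the Jacobian determinant of `F` vanishes. -/
def J0 : Set (ℝ × ℝ) := {q ∈ D | jacF q = 0}

/-- The connected piece of `D \ J₀` which contains `(√2/2, 0)`. -/
def U : Set (ℝ × ℝ) := connectedComponentIn (D \ J0) (√2 / 2, 0)

/-- The other piece of `D \ J₀`. -/
def V : Set (ℝ × ℝ) := (D \ J0) \ U

/-- `D₂ = V ∪ J₀`. -/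
def D2 : Set (ℝ × ℝ) := V ∪ J0

/-- The endpoint of the envelope `F(J₀)` which comes from `x = 1`. -/
def I1 : Plane := F (1, arccos (-deriv rad 1 / deriv cen 1))

end Quadrisection

end

open Real Set MeasureTheory

noncomputable section

namespace Quadrisection

/-! ### The curve of solutions of the area equation -/

/-! A line that halves the area of a triangle cuts off a corner and has one free parameter there.
Two such lines at the same corner never quarter the area (`not_quarters_same`), so the segments
belong to different corners. Both then end on the edge joining these corners, at fractions `x` and
`y` of that edge measured from its two ends. The piece over that edge has relative area
`(x+y-1)²/(2x²+2y²-1)` (`volume_cut_adjacent`). Setting this to 1/4 gives a symmetric conic whose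
relevant branch is `y = yOf x`, an involution exchanging `√2/2` and `1`. Scale the edge to the
segment from `(0,0)` to `(1,0)`: on this branch perpendicularity says that the third vertex lies on
the circle with center `(cen x, 0)` and radius `rad x`, that is, `power` vanishes (`inner_chords`).
So `quads_eq` counts zeros of `power`, edge by edge, on a half-open interval that represents each
median once.

With the other two edges read backwards (`encard_zeros_swap`), the third vertices for the middle,
shortest and longest sides are `C`, its inverse `C'` about the unit circle at `(1,0)`, and its
inverse about the unit circle at the origin (`quads_eq_total`).

The derivative of `power H N` is `2 c'(x) (envAbs x - H)` with `c' > 0`, and `envAbs` is strictly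
increasing (`envAbs_strictMonoOn`). Hence `power` falls while `envAbs x < H` and rises afterwards.
Its end values are `N - 1` and `N - 2H`: of signs `≥ 0, ≤ 0` for `C`, both `≤ 0` for the longest
side, both `≥ 0` for `C'`. Apart from isosceles ties, the middle side gives one zero, the longest
none, and `C'` gives 0, 1 or 2. Since the Jacobian is `c'(x)(h - envAbs x)`, membership in `F(D₂)`
means a zero that is not on the falling branch, and membership in `F(J₀)` a zero at the minimum;
this decides the count (`total_cases`). -/

lemma discr_pos (x : ℝ) : 0 < 12 * x ^ 2 - 16 * x + 6 := by
  nlinarith [sq_nonneg (3 * x - 2)]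

/-- The quantity is half the square root in `yOf`, so its sign singles out the larger root of the
area equation. -/
lemma yOf_add_pos (x : ℝ) : 0 < yOf x + 2 * x - 2 := by
  have := Real.sqrt_pos.2 (discr_pos x)
  unfold yOf; linarith

lemma yOf_area (x : ℝ) :
    yOf x ^ 2 + 4 * (x - 1) * yOf x + x ^ 2 - 4 * x + 5 / 2 = 0 := by
  have := Real.sq_sqrt (discr_pos x).le
  unfold yOf; linear_combination this / 4

lemma eq_yOf {x y : ℝ} (h : y ^ 2 + 4 * (x - 1) * y + x ^ 2 - 4 * x + 5 / 2 = 0)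
    (hp : 0 ≤ y + 2 * x - 2) : y = yOf x := by
  have h1 := yOf_area x
  have h2 := yOf_add_pos x
  have : (y - yOf x) * (y + yOf x + 4 * (x - 1)) = 0 := by linear_combination h - h1
  rcases mul_eq_zero.1 this with h | h <;> linarith

/-- The area equation is symmetric, and this says that `x` is in turn the larger root belonging to
`yOf x`. That makes `yOf` an involution. -/
lemma add_yOf_pos (x : ℝ) : 0 < x + 2 * yOf x - 2 := by
  have h := yOf_add_pos x
  have h1 : (yOf x + 2 * x - 2) * (x + 2 * yOf x - 2) = (1 + 2 * (x - yOf x) ^ 2) / 4 := by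
    linear_combination (3 / 2 : ℝ) * yOf_area x
  have h2 : 0 < (yOf x + 2 * x - 2) * (x + 2 * yOf x - 2) := by rw [h1]; positivity
  exact pos_of_mul_pos_right h2 h.le

lemma yOf_yOf (x : ℝ) : yOf (yOf x) = x :=
  (eq_yOf (by linear_combination yOf_area x) (by linarith [add_yOf_pos x])).symm

lemma sqrt_two_half_sq : (√2 / 2) ^ 2 = (1 / 2 : ℝ) := by
  rw [div_pow, Real.sq_sqrt zero_le_two]; norm_num

lemma sqrt_two_half_gt : (7 / 10 : ℝ) < √2 / 2 := by
  have := sqrt_two_half_sq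
  have h : 0 ≤ √2 / 2 := by positivity
  nlinarith

lemma sqrt_two_half_lt : √2 / 2 < (71 / 100 : ℝ) := by
  have := sqrt_two_half_sq
  have h : 0 ≤ √2 / 2 := by positivity
  nlinarith

lemma yOf_one : yOf 1 = √2 / 2 := by
  symm
  apply eq_yOf
  · linear_combination sqrt_two_half_sq
  · linarith [sqrt_two_half_gt]

lemma yOf_sqrt_two_half : yOf (√2 / 2) = 1 := by
  rw [← yOf_one, yOf_yOf]

lemma hasDerivAt_yOf (x : ℝ) :
    HasDerivAt yOf (-((x + 2 * yOf x - 2) / (yOf x + 2 * x - 2))) x := by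
  have h0 := discr_pos x
  have h1 : HasDerivAt (fun x : ℝ => 12 * x ^ 2 - 16 * x + 6) (24 * x - 16) x := by
    have := (((hasDerivAt_pow 2 x).const_mul 12).sub ((hasDerivAt_id x).const_mul 16)).add_const 6
    refine HasDerivAt.congr_deriv (f' := _) this ?_
    norm_num; ring
  have h2 : HasDerivAt yOf (-2 + (24 * x - 16) / (2 * √(12 * x ^ 2 - 16 * x + 6)) / 2) x := by
    have h4 := ((hasDerivAt_id x).const_mul (2 : ℝ)).const_sub (2 : ℝ)
    refine HasDerivAt.congr_deriv (h4.add ((h1.sqrt h0.ne').div_const 2)) ?_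
    norm_num
  refine h2.congr_deriv ?_
  have h5 : √(12 * x ^ 2 - 16 * x + 6) = 2 * (yOf x + 2 * x - 2) := by unfold yOf; ring
  have h6 := (yOf_add_pos x).ne'
  rw [h5]
  field_simp; ring

lemma yOf_strictAnti : StrictAnti yOf := by
  apply strictAnti_of_hasDerivAt_neg hasDerivAt_yOf
  intro x
  have := div_pos (add_yOf_pos x) (yOf_add_pos x)
  linarith

lemma yOf_mem {x : ℝ} (hx : x ∈ Icc (√2 / 2) 1) : yOf x ∈ Icc (√2 / 2) 1 := by
  constructor
  · rw [← yOf_one]; exact yOf_strictAnti.antitone hx.2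
  · rw [← yOf_sqrt_two_half]; exact yOf_strictAnti.antitone hx.1

/-! ### Derivatives of the center and the radius. -/

lemma hasDerivAt_cen (x : ℝ) : HasDerivAt cen
    (2 * (6 * (x + yOf x - 1) ^ 2 - 1) / (2 * (yOf x + 2 * x - 2))) x := by
  have h := ((hasDerivAt_pow 2 x).sub ((hasDerivAt_yOf x).pow 2)).add_const (1 / 2)
  refine HasDerivAt.congr_deriv h ?_
  have h6 := (yOf_add_pos x).ne'
  norm_num
  field_simp
  linear_combination (-2 : ℝ) * yOf_area x

lemma hasDerivAt_rad (x : ℝ) : HasDerivAt rad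
    (8 * (x + yOf x - 1) * (x - yOf x) / (2 * (yOf x + 2 * x - 2))) x := by
  have h := ((hasDerivAt_pow 2 x).add ((hasDerivAt_yOf x).pow 2)).sub_const (1 / 2)
  refine HasDerivAt.congr_deriv h ?_
  have h6 := (yOf_add_pos x).ne'
  norm_num
  field_simp
  ring

lemma rad_eq (x : ℝ) : rad x = 2 * (x + yOf x - 1) ^ 2 := by
  unfold rad; linear_combination (-1 : ℝ) * yOf_area x

/-- With `S = x + y - 1` the area equation reads `(x - y)² = 3S² - 2S`, so `S > 0` forces `S ≥ 2/3`.
-/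
lemma two_thirds_le (x : ℝ) : 2 / 3 ≤ x + yOf x - 1 := by
  have h1 := yOf_add_pos x
  have h2 := add_yOf_pos x
  nlinarith [yOf_area x, sq_nonneg (x - yOf x)]

lemma rad_pos (x : ℝ) : 0 < rad x := by
  rw [rad_eq]; have := two_thirds_le x; positivity

lemma deriv_cen_pos (x : ℝ) : 0 < deriv cen x := by
  rw [(hasDerivAt_cen x).deriv]
  have := yOf_add_pos x
  have h2 := two_thirds_le x
  have : 0 < 6 * (x + yOf x - 1) ^ 2 - 1 := by nlinarith
  positivity

/-- `(h - c(x))² + t² - r(x)²` for a point `(h, t)` with `h = H` and `h² + t² = N`: it vanishes when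
the circle of parameter `x` goes through the point. -/
def power (H N x : ℝ) : ℝ := N - 2 * H * cen x + 2 * x ^ 2 * (1 - 2 * yOf x ^ 2)

lemma power_eq (h t x : ℝ) :
    power h (h ^ 2 + t ^ 2) x = (h - cen x) ^ 2 + t ^ 2 - rad x ^ 2 := by
  unfold power cen rad; ring

lemma power_swap (H N x : ℝ) : power H N (yOf x) = power (1 - H) (N + 1 - 2 * H) x := by
  unfold power cen; rw [yOf_yOf]; ring

/-- The abscissa of the point at which the circle of parameter `x` touches the envelope. -/
def envAbs (x : ℝ) : ℝ := 1 / 2 + (-2 * (x + yOf x - 1) ^ 3 + 6 * (x + yOf x - 1) ^ 2 -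
  (x + yOf x - 1) - 1) / (6 * (x + yOf x - 1) ^ 2 - 1) * (x - yOf x)

/-- Setting the `x`-derivative of `(h - c)² + t² - r²` to zero gives `h = c - r r'/c'`; this is that
formula without the division. -/
lemma envAbs_spec (x : ℝ) :
    deriv cen x * (cen x - envAbs x) = rad x * deriv rad x := by
  rw [(hasDerivAt_cen x).deriv, (hasDerivAt_rad x).deriv, rad_eq]
  have h1 := yOf_add_pos x
  have h2 := two_thirds_le x
  have h3 : 6 * (x + yOf x - 1) ^ 2 - 1 ≠ 0 := by nlinarith
  have hc : cen x = 1 / 2 + (x - yOf x) * (x + yOf x) := by unfold cen; ring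
  rw [hc]; unfold envAbs
  field_simp
  ring

lemma hasDerivAt_power (H N x : ℝ) :
    HasDerivAt (power H N) (2 * deriv cen x * (envAbs x - H)) x := by
  have hc : HasDerivAt cen (deriv cen x) x := (hasDerivAt_cen x).differentiableAt.hasDerivAt
  have hr : HasDerivAt rad (deriv rad x) x := (hasDerivAt_rad x).differentiableAt.hasDerivAt
  have h := (((hc.const_mul (2 * H)).const_sub N).add (hc.pow 2)).sub (hr.pow 2)
  have e : power H N = fun x => N - 2 * H * cen x + cen x ^ 2 - rad x ^ 2 := by
    funext x; unfold power cen rad; ring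
  rw [e]
  refine HasDerivAt.congr_deriv h ?_
  norm_num
  linear_combination (2 : ℝ) * envAbs_spec x

/-- At a point of the circle of parameter `x`, the Jacobian therefore has the sign opposite to the
slope of `power` at `x`, and vanishes exactly at tangency with the envelope. -/
lemma jacF_eq (x θ : ℝ) :
    jacF (x, θ) = deriv cen x * (cen x + rad x * cos θ - envAbs x) := by
  unfold jacF
  linear_combination (-1 : ℝ) * envAbs_spec x

/-! ### Monotonicity of the abscissa of the envelope. -/

lemma continuous_yOf : Continuous yOf :=
  continuous_iff_continuousAt.2 fun x => (hasDerivAt_yOf x).continuousAt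

lemma continuous_envAbs : Continuous envAbs := by
  have := continuous_yOf
  unfold envAbs
  refine Continuous.add continuous_const (Continuous.mul (Continuous.div (by fun_prop)
    (by fun_prop) ?_) (by fun_prop))
  intro x
  have := two_thirds_le x
  nlinarith

lemma add_yOf_le {x : ℝ} (hx : x ∈ Icc (√2 / 2) 1) : x + yOf x - 1 ≤ 3 / 4 := by
  have h := yOf_mem hx
  have h7 := sqrt_two_half_gt
  have h2 := two_thirds_le x
  have h3 : (x - yOf x) ^ 2 ≤ (3 / 10) ^ 2 :=
    sq_le_sq' (by linarith [h.2, hx.1]) (by linarith [h.1, hx.2])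
  nlinarith [yOf_area x]

/-- Write `envAbs x = 1/2 + φ(S) d` with `S = x + y - 1` and `d = x - y`. Here `φ` is positive and
increasing on `[2/3, 3/4]`, `d` increases with `x`, and `S` grows with `|d|`. -/
lemma envAbs_strictMonoOn : StrictMonoOn envAbs (Icc (√2 / 2) 1) := by
  have key : ∀ S₁ S₂ : ℝ, 2 / 3 ≤ S₁ → S₁ ≤ S₂ → S₂ ≤ 3 / 4 →
      (-2 * S₁ ^ 3 + 6 * S₁ ^ 2 - S₁ - 1) / (6 * S₁ ^ 2 - 1) ≤
      (-2 * S₂ ^ 3 + 6 * S₂ ^ 2 - S₂ - 1) / (6 * S₂ ^ 2 - 1) := by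
    intro S₁ S₂ h1 h2 h3
    have d1 : 0 < 6 * S₁ ^ 2 - 1 := by nlinarith
    have d2 : 0 < 6 * S₂ ^ 2 - 1 := by nlinarith
    have u1 : 6 * S₁ ^ 2 - 1 ≤ 3 := by nlinarith
    have u2 : 6 * S₂ ^ 2 - 1 ≤ 3 := by nlinarith
    rw [div_le_div_iff₀ d1 d2]
    -- The second factor is positive: `4(6 S₁S₂ + 1) ≥ 44/3`, while the subtracted product is at
    -- most 9.
    have e : (-2 * S₂ ^ 3 + 6 * S₂ ^ 2 - S₂ - 1) * (6 * S₁ ^ 2 - 1) -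
      (-2 * S₁ ^ 3 + 6 * S₁ ^ 2 - S₁ - 1) * (6 * S₂ ^ 2 - 1) =
      (S₂ - S₁) * (4 * (6 * (S₁ * S₂) + 1) - (6 * S₁ ^ 2 - 1) * (6 * S₂ ^ 2 - 1)) / 3 := by ring
    have p1 : 4 / 9 ≤ S₁ * S₂ := by nlinarith
    have p2 : (6 * S₁ ^ 2 - 1) * (6 * S₂ ^ 2 - 1) ≤ 3 * 3 :=
      mul_le_mul u1 u2 d2.le (by norm_num)
    have p3 : 0 ≤ (S₂ - S₁) * (4 * (6 * (S₁ * S₂) + 1) -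
      (6 * S₁ ^ 2 - 1) * (6 * S₂ ^ 2 - 1)) := mul_nonneg (by linarith) (by linarith)
    linarith
  have pos : ∀ S : ℝ, 2 / 3 ≤ S → S ≤ 3 / 4 →
      0 < (-2 * S ^ 3 + 6 * S ^ 2 - S - 1) / (6 * S ^ 2 - 1) := by
    intro S h1 h2
    apply div_pos <;> nlinarith
  intro x hx z hz hxz
  have hd : x - yOf x < z - yOf z := by linarith [yOf_strictAnti hxz]
  have sx := two_thirds_le x
  have sz := two_thirds_le z
  have tx := add_yOf_le hx
  have tz := add_yOf_le hz
  have ax := yOf_area x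
  have az := yOf_area z
  have px := pos _ sx tx
  have pz := pos _ sz tz
  unfold envAbs
  set S := x + yOf x - 1 with hS
  set R := z + yOf z - 1 with hR
  have e1 : (x - yOf x) ^ 2 = 3 * S ^ 2 - 2 * S := by rw [hS]; linear_combination (-2 : ℝ) * ax
  have e2 : (z - yOf z) ^ 2 = 3 * R ^ 2 - 2 * R := by rw [hR]; linear_combination (-2 : ℝ) * az
  have mono : ∀ S₁ S₂ d₁ d₂ : ℝ, 2 / 3 ≤ S₁ → 2 / 3 ≤ S₂ → d₁ ^ 2 = 3 * S₁ ^ 2 - 2 * S₁ →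
      d₂ ^ 2 = 3 * S₂ ^ 2 - 2 * S₂ → d₁ ^ 2 ≤ d₂ ^ 2 → S₁ ≤ S₂ := by
    intro S₁ S₂ d₁ d₂ h1 h2 h3 h4 h5
    by_contra hc
    push Not at hc
    nlinarith [mul_pos (sub_pos.2 hc) (by linarith : 0 < 3 * (S₁ + S₂) - 2)]
  clear_value S R
  generalize x - yOf x = d at *
  generalize z - yOf z = e at *
  -- For `d ≥ 0`, `|d|` and `φ` both grow; if both differences are negative, both shrink; opposite
  -- signs need only `φ > 0`.
  rcases le_or_gt 0 d with h0 | h0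
  · have h1 := key S R sx (mono S R d e sx sz e1 e2 (by nlinarith)) tz
    have h2 := mul_le_mul_of_nonneg_right h1 h0
    have h3 := mul_lt_mul_of_pos_left hd pz
    linarith
  · rcases le_or_gt 0 e with h0' | h0'
    · have h1 := mul_nonneg pz.le h0'
      have h2 := mul_neg_of_pos_of_neg px h0
      linarith
    · have h1 := key R S sz (mono R S e d sz sx e2 e1 (by nlinarith)) tx
      have h2 := mul_le_mul_of_nonpos_right h1 h0'.le
      have h3 := mul_lt_mul_of_pos_left hd px
      linarith

lemma continuous_power (H N : ℝ) : Continuous (power H N) :=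
  continuous_iff_continuousAt.2 fun x => (hasDerivAt_power H N x).continuousAt

lemma power_strictAntiOn {H N x : ℝ} (hx : x ∈ Icc (√2 / 2) 1) (h : envAbs x ≤ H) :
    StrictAntiOn (power H N) (Icc (√2 / 2) x) := by
  apply strictAntiOn_of_deriv_neg (convex_Icc _ _) (continuous_power H N).continuousOn
  intro z hz
  rw [interior_Icc] at hz
  rw [(hasDerivAt_power H N z).deriv]
  have h1 := envAbs_strictMonoOn ⟨hz.1.le, hz.2.le.trans hx.2⟩ hx hz.2
  have := deriv_cen_pos z
  exact mul_neg_of_pos_of_neg (by positivity) (by linarith)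

lemma power_strictMonoOn {H N x : ℝ} (hx : x ∈ Icc (√2 / 2) 1) (h : H ≤ envAbs x) :
    StrictMonoOn (power H N) (Icc x 1) := by
  apply strictMonoOn_of_deriv_pos (convex_Icc _ _) (continuous_power H N).continuousOn
  intro z hz
  rw [interior_Icc] at hz
  rw [(hasDerivAt_power H N z).deriv]
  have h1 := envAbs_strictMonoOn hx ⟨hx.1.trans hz.1.le, hz.2.le⟩ hz.1
  have := deriv_cen_pos z
  exact mul_pos (by positivity) (by linarith)

lemma cen_one : cen 1 = 1 := by
  unfold cen; rw [yOf_one]; linear_combination (-1 : ℝ) * sqrt_two_half_sq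

lemma rad_one : rad 1 = 1 := by
  unfold rad; rw [yOf_one]; linear_combination sqrt_two_half_sq

lemma power_one (H N : ℝ) : power H N 1 = N - 2 * H := by
  unfold power; rw [cen_one, yOf_one]; linear_combination (-4 : ℝ) * sqrt_two_half_sq

lemma power_sqrt_two_half (H N : ℝ) : power H N (√2 / 2) = N - 1 := by
  unfold power cen; rw [yOf_sqrt_two_half]
  linear_combination (-2 * H - 2 : ℝ) * sqrt_two_half_sq

/-! ### The domain `D`, its pieces, and the map `F` -/

/-- The circle meets the axis on the right at `c + r = 2x²`. -/
lemma deriv_cen_add_deriv_rad (x : ℝ) : deriv cen x + deriv rad x = 4 * x := by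
  rw [(hasDerivAt_cen x).deriv, (hasDerivAt_rad x).deriv]
  have h := (yOf_add_pos x).ne'
  field_simp
  linear_combination (4 : ℝ) * yOf_area x

/-- On the left the circle meets the axis at `c - r = 1 - 2y²`, and `y` decreases. With the previous
lemma, `-r'/c'` lies in `[-1, 1]` at `x = 1`, so the `arccos` in `I1` is not clamped. -/
lemma deriv_rad_le_deriv_cen {x : ℝ} (hx : 0 ≤ yOf x) : deriv rad x ≤ deriv cen x := by
  have h0 := yOf_add_pos x
  have h1 := add_yOf_pos x
  have h2 : deriv cen x - deriv rad x = 4 * yOf x * (x + 2 * yOf x - 2) / (yOf x + 2 * x - 2) := by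
    rw [(hasDerivAt_cen x).deriv, (hasDerivAt_rad x).deriv]
    field_simp
    linear_combination (4 : ℝ) * yOf_area x
  have h3 : 0 ≤ 4 * yOf x * (x + 2 * yOf x - 2) / (yOf x + 2 * x - 2) := by positivity
  linarith

lemma continuous_cen : Continuous cen :=
  continuous_iff_continuousAt.2 fun x => (hasDerivAt_cen x).continuousAt

lemma continuous_rad : Continuous rad :=
  continuous_iff_continuousAt.2 fun x => (hasDerivAt_rad x).continuousAt

lemma continuous_deriv_cen : Continuous (deriv cen) := by
  have h : deriv cen = fun x =>
      2 * (6 * (x + yOf x - 1) ^ 2 - 1) / (2 * (yOf x + 2 * x - 2)) :=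
    funext fun x => (hasDerivAt_cen x).deriv
  have := continuous_yOf
  rw [h]
  exact Continuous.div (by fun_prop) (by fun_prop)
    fun x => mul_ne_zero two_ne_zero (yOf_add_pos x).ne'

lemma continuous_jacF : Continuous jacF := by
  have h : jacF = fun q => deriv cen q.1 * (cen q.1 + rad q.1 * cos q.2 - envAbs q.1) :=
    funext fun q => jacF_eq q.1 q.2
  have := continuous_cen
  have := continuous_rad
  have := continuous_deriv_cen
  have := continuous_envAbs
  rw [h]
  fun_prop

lemma sqrt_two_half_le_one : √2 / 2 ≤ 1 := by linarith [sqrt_two_half_lt]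

lemma cos_thetaMax {x : ℝ} (hx : x ∈ Icc (√2 / 2) 1) :
    cos (thetaMax x) = (1 / 2 - cen x) / rad x := by
  have hr := rad_pos x
  have hy := (yOf_mem hx).1
  have h := sqrt_two_half_sq
  have h0 := sqrt_two_half_gt
  apply Real.cos_arccos
  · rw [le_div_iff₀ hr]; unfold cen rad; nlinarith
  · rw [div_le_iff₀ hr]; unfold cen rad; nlinarith [hx.1]

/-- Cosine decreases on `[0, π]`, so the bound by `thetaMax` says that the image point has abscissa
at least 1/2. -/
lemma mem_D_iff {x θ : ℝ} : (x, θ) ∈ D ↔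
    x ∈ Icc (√2 / 2) 1 ∧ θ ∈ Icc 0 π ∧ 1 / 2 ≤ cen x + rad x * cos θ := by
  have hr := rad_pos x
  constructor
  · rintro ⟨hx, h0, h1⟩
    dsimp only at hx h0 h1
    have h2 : θ ≤ π := h1.trans (Real.arccos_le_pi _)
    refine ⟨hx, ⟨h0, h2⟩, ?_⟩
    have h3 := Real.cos_le_cos_of_nonneg_of_le_pi h0 (Real.arccos_le_pi _) h1
    change cos (thetaMax x) ≤ _ at h3
    rw [cos_thetaMax hx, div_le_iff₀ hr] at h3
    linarith
  · rintro ⟨hx, hθ, h⟩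
    refine ⟨hx, hθ.1, ?_⟩
    by_contra hc
    have h3 := Real.cos_lt_cos_of_nonneg_of_le_pi (Real.arccos_nonneg _) hθ.2 (not_le.1 hc)
    change _ < cos (thetaMax x) at h3
    rw [cos_thetaMax hx, lt_div_iff₀ hr] at h3
    linarith

/-- The Jacobian cannot change sign on a connected set avoiding `J₀`; conversely its positive part
is connected, because the Jacobian is positive on `θ = 0` and decreases in `θ`. -/
lemma U_eq : U = {q ∈ D | 0 < jacF q} := by
  have hDJ : D \ J0 = {q ∈ D | jacF q ≠ 0} := by
    ext q; simp only [J0, mem_sdiff, mem_ofPred_eq]; tauto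
  have jac0 : ∀ x ∈ Icc (√2 / 2) 1, 0 < jacF (x, 0) := by
    intro x hx
    have h1 := rad_pos x
    have h2 := deriv_cen_add_deriv_rad x
    have h3 := sqrt_two_half_gt.trans_le hx.1
    have : jacF (x, 0) = rad x * (4 * x) := by rw [← h2]; unfold jacF; simp; ring
    rw [this]; positivity
  have base : ∀ x ∈ Icc (√2 / 2) 1, (x, (0 : ℝ)) ∈ {q ∈ D | 0 < jacF q} :=
    fun x hx => ⟨⟨hx, le_rfl, Real.arccos_nonneg _⟩, jac0 x hx⟩
  have ha : (√2 / 2) ∈ Icc (√2 / 2) 1 := ⟨le_rfl, sqrt_two_half_le_one⟩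
  apply Subset.antisymm
  · intro q hq
    have hq' : q ∈ D \ J0 := connectedComponentIn_subset _ _ hq
    rw [hDJ] at hq'
    refine ⟨hq'.1, ?_⟩
    by_contra hc
    have ha' : (√2 / 2, (0 : ℝ)) ∈ U := mem_connectedComponentIn (by
      rw [hDJ]; exact ⟨(base _ ha).1, (base _ ha).2.ne'⟩)
    have := isPreconnected_connectedComponentIn.intermediate_value hq ha'
      continuous_jacF.continuousOn ⟨not_lt.1 hc, (base _ ha).2.le⟩
    obtain ⟨p, hp, hp0⟩ := this
    have hp' := connectedComponentIn_subset _ _ hp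
    rw [hDJ] at hp'
    exact hp'.2 hp0
  · apply IsPreconnected.subset_connectedComponentIn _ (base _ ha)
    · rw [hDJ]; exact fun q hq => ⟨hq.1, hq.2.ne'⟩
    apply isPreconnected_of_forall (√2 / 2, (0 : ℝ))
    rintro ⟨x, θ⟩ ⟨hD, hj⟩
    have hx : x ∈ Icc (√2 / 2) 1 := hD.1
    have hθ : 0 ≤ θ := hD.2.1
    -- An L-shaped connected set: the whole bottom edge together with the vertical segment below the
    -- given point.
    refine ⟨Icc (√2 / 2) 1 ×ˢ {0} ∪ {x} ×ˢ Icc 0 θ, ?_, Or.inl ⟨ha, rfl⟩,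
      Or.inr ⟨rfl, hθ, le_rfl⟩, ?_⟩
    · rintro ⟨x', θ'⟩ (⟨h1, h2⟩ | ⟨h1, h2⟩)
      · obtain rfl : θ' = 0 := h2
        exact base _ h1
      · obtain rfl : x' = x := h1
        have h2' : θ' ∈ Icc 0 θ := h2
        have hd : (x', θ') ∈ D := ⟨hx, h2'.1, h2'.2.trans hD.2.2⟩
        refine ⟨hd, ?_⟩
        have hcos : cos θ ≤ cos θ' := Real.cos_le_cos_of_nonneg_of_le_pi h2'.1
          (hD.2.2.trans (Real.arccos_le_pi _)) h2'.2
        have h3 := mul_le_mul_of_nonneg_left hcos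
          (mul_pos (deriv_cen_pos x') (rad_pos x')).le
        change 0 < jacF (x', θ) at hj
        unfold jacF at hj ⊢
        simp only at hj ⊢
        linarith
    · exact IsPreconnected.union (x, 0) ⟨hx, rfl⟩ ⟨rfl, le_rfl, hθ⟩
        (isPreconnected_Icc.prod isPreconnected_singleton)
        (isPreconnected_singleton.prod isPreconnected_Icc)

lemma D2_eq : D2 = {q ∈ D | jacF q ≤ 0} := by
  unfold D2 V
  rw [U_eq]
  ext q
  simp only [J0, mem_union, mem_sdiff, mem_ofPred_eq]
  constructor
  · rintro (⟨⟨h1, -⟩, h2⟩ | ⟨h1, h2⟩)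
    · exact ⟨h1, not_lt.1 fun h => h2 ⟨h1, h⟩⟩
    · exact ⟨h1, h2.le⟩
  · rintro ⟨h1, h2⟩
    rcases h2.lt_or_eq with h | h
    · exact Or.inl ⟨⟨h1, fun h' => h.ne h'.2⟩, fun h' => absurd h'.2 (not_lt.2 h2)⟩
    · exact Or.inr ⟨h1, h⟩

/-- Since `t > 0`, a circle through the point determines `θ` as an `arccos`; preimages under `F` are
thus circles through the point. The predicate `p` lets one proof serve both `D2` and `J0`. -/
lemma mem_F_image {h t : ℝ} (hh : 1 / 2 ≤ h) (ht : 0 < t) (p : ℝ → Prop) :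
    !₂[h, t] ∈ F '' {q ∈ D | p (jacF q)} ↔
      ∃ x ∈ Icc (√2 / 2) 1, power h (h ^ 2 + t ^ 2) x = 0 ∧
        p (deriv cen x * (h - envAbs x)) := by
  constructor
  · rintro ⟨⟨x, θ⟩, ⟨hD, hp⟩, hF⟩
    have h0 : cen x + rad x * cos θ = h := by
      have := congrArg (fun v : Plane => v 0) hF
      simpa [F] using this
    have h1 : rad x * sin θ = t := by
      have := congrArg (fun v : Plane => v 1) hF
      simpa [F] using this
    refine ⟨x, hD.1, ?_, ?_⟩
    · rw [power_eq, ← h0, ← h1]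
      linear_combination rad x ^ 2 * Real.sin_sq_add_cos_sq θ
    · rwa [jacF_eq, h0] at hp
  · rintro ⟨x, hx, h0, hp⟩
    have hr := rad_pos x
    rw [power_eq] at h0
    have hq : ((h - cen x) / rad x) ^ 2 + (t / rad x) ^ 2 = 1 := by
      field_simp; linarith
    have hcos : cos (arccos ((h - cen x) / rad x)) = (h - cen x) / rad x := by
      apply Real.cos_arccos <;> nlinarith [sq_nonneg (t / rad x)]
    have hsin : sin (arccos ((h - cen x) / rad x)) = t / rad x := by
      rw [Real.sin_arccos, ← Real.sqrt_sq (div_pos ht hr).le]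
      congr 1; linarith
    have hh' : cen x + rad x * cos (arccos ((h - cen x) / rad x)) = h := by
      rw [hcos]; field_simp; ring
    refine ⟨(x, arccos ((h - cen x) / rad x)), ⟨mem_D_iff.2 ⟨hx, ⟨Real.arccos_nonneg _,
      Real.arccos_le_pi _⟩, by rwa [hh']⟩, ?_⟩, ?_⟩
    · rw [jacF_eq, hh']; exact hp
    · have h1 : rad x * sin (arccos ((h - cen x) / rad x)) = t := by
        rw [hsin]; field_simp
      unfold F
      dsimp only
      rw [hh', h1]

lemma mem_F_D2 {h t : ℝ} (hh : 1 / 2 ≤ h) (ht : 0 < t) : !₂[h, t] ∈ F '' D2 ↔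
    ∃ x ∈ Icc (√2 / 2) 1, power h (h ^ 2 + t ^ 2) x = 0 ∧ h ≤ envAbs x := by
  rw [D2_eq, mem_F_image hh ht (· ≤ 0)]
  refine exists_congr fun x => and_congr_right fun _ => and_congr_right fun _ => ?_
  have := deriv_cen_pos x
  constructor
  · intro h1
    by_contra hc
    linarith [mul_pos this (sub_pos.2 (not_le.1 hc))]
  · exact fun h1 => mul_nonpos_of_nonneg_of_nonpos this.le (sub_nonpos.2 h1)

lemma mem_F_J0 {h t : ℝ} (hh : 1 / 2 ≤ h) (ht : 0 < t) : !₂[h, t] ∈ F '' J0 ↔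
    ∃ x ∈ Icc (√2 / 2) 1, power h (h ^ 2 + t ^ 2) x = 0 ∧ h = envAbs x := by
  unfold J0
  rw [mem_F_image hh ht (· = 0)]
  refine exists_congr fun x => and_congr_right fun _ => and_congr_right fun _ => ?_
  have := (deriv_cen_pos x).ne'
  rw [mul_eq_zero, or_iff_right this, sub_eq_zero]

lemma eq_I1_iff {h t : ℝ} (ht : 0 < t) : !₂[h, t] = I1 ↔
    power h (h ^ 2 + t ^ 2) 1 = 0 ∧ h = envAbs 1 := by
  have hc := deriv_cen_pos 1
  have hu : cos (arccos (-deriv rad 1 / deriv cen 1)) = -deriv rad 1 / deriv cen 1 := by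
    apply Real.cos_arccos
    · rw [le_div_iff₀ hc]
      linarith [deriv_rad_le_deriv_cen (x := 1) (by rw [yOf_one]; positivity)]
    · rw [div_le_iff₀ hc]; linarith [deriv_cen_add_deriv_rad 1]
  have henv : cen 1 + rad 1 * cos (arccos (-deriv rad 1 / deriv cen 1)) = envAbs 1 := by
    have := envAbs_spec 1
    rw [hu, rad_one]
    rw [rad_one] at this
    field_simp
    linarith
  have hs : 0 ≤ sin (arccos (-deriv rad 1 / deriv cen 1)) :=
    Real.sin_nonneg_of_nonneg_of_le_pi (Real.arccos_nonneg _) (Real.arccos_le_pi _)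
  set θ := arccos (-deriv rad 1 / deriv cen 1) with hθ
  have e : power (envAbs 1) (envAbs 1 ^ 2 + t ^ 2) 1 = t ^ 2 - sin θ ^ 2 := by
    rw [power_eq, ← henv, rad_one]; linear_combination Real.sin_sq_add_cos_sq θ
  constructor
  · intro hI
    have h0 : h = cen 1 + rad 1 * cos θ := by
      have := congrArg (fun v : Plane => v 0) hI
      simpa [I1, F] using this
    have h1 : t = rad 1 * sin θ := by
      have := congrArg (fun v : Plane => v 1) hI
      simpa [I1, F] using this
    rw [henv] at h0
    subst h0
    rw [e, h1, rad_one]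
    exact ⟨by ring, rfl⟩
  · rintro ⟨h0, rfl⟩
    rw [e] at h0
    have : t = sin θ := by nlinarith
    unfold I1 F
    rw [← hθ]
    dsimp only
    rw [henv, rad_one, one_mul, ← this]

/-! ### Counting the circles through a point -/

/-- The parameters in `I` of the circles through the point with abscissa `H` at distance `√N` from
the origin. -/
def zeros (H N : ℝ) (I : Set ℝ) : Set ℝ := {x ∈ I | power H N x = 0}

lemma encard_zeros_Ioc (H N : ℝ) : (zeros H N (Ioc (√2 / 2) 1)).encard +
    (if N = 1 then 1 else 0) = (zeros H N (Icc (√2 / 2) 1)).encard := by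
  have ha : power H N (√2 / 2) = 0 ↔ N = 1 := by rw [power_sqrt_two_half, sub_eq_zero]
  have e : zeros H N (Ioc (√2 / 2) 1) = zeros H N (Icc (√2 / 2) 1) \ {√2 / 2} := by
    ext x
    simp only [zeros, mem_ofPred_eq, mem_sdiff, mem_Ioc, mem_Icc, mem_singleton_iff]
    constructor
    · rintro ⟨⟨h1, h2⟩, h3⟩; exact ⟨⟨⟨h1.le, h2⟩, h3⟩, h1.ne'⟩
    · rintro ⟨⟨⟨h1, h2⟩, h3⟩, h4⟩; exact ⟨⟨h1.lt_of_ne' h4, h2⟩, h3⟩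
  rw [e]
  split_ifs with h
  · exact encard_sdiff_singleton_add_one ⟨⟨le_rfl, sqrt_two_half_le_one⟩, ha.2 h⟩
  · rw [sdiff_singleton_eq_self fun hh => h (ha.1 hh.2), add_zero]

lemma encard_zeros_Ico (H N : ℝ) : (zeros H N (Ico (√2 / 2) 1)).encard +
    (if N = 2 * H then 1 else 0) = (zeros H N (Icc (√2 / 2) 1)).encard := by
  have ha : power H N 1 = 0 ↔ N = 2 * H := by rw [power_one, sub_eq_zero]
  have e : zeros H N (Ico (√2 / 2) 1) = zeros H N (Icc (√2 / 2) 1) \ {1} := by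
    ext x
    simp only [zeros, mem_ofPred_eq, mem_sdiff, mem_Ico, mem_Icc, mem_singleton_iff]
    constructor
    · rintro ⟨⟨h1, h2⟩, h3⟩; exact ⟨⟨⟨h1, h2.le⟩, h3⟩, h2.ne⟩
    · rintro ⟨⟨⟨h1, h2⟩, h3⟩, h4⟩; exact ⟨⟨h1, h2.lt_of_ne h4⟩, h3⟩
  rw [e]
  split_ifs with h
  · exact encard_sdiff_singleton_add_one ⟨⟨sqrt_two_half_le_one, le_rfl⟩, ha.2 h⟩
  · rw [sdiff_singleton_eq_self fun hh => h (ha.1 hh.2), add_zero]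

/-- Reading the edge from its other end exchanges `x` with `yOf x` and reflects the third vertex in
the line `h = 1/2`; the included endpoint moves from `1` to `√2/2`. -/
lemma encard_zeros_swap (H N : ℝ) : (zeros H N (Ioc (√2 / 2) 1)).encard =
    (zeros (1 - H) (N + 1 - 2 * H) (Ico (√2 / 2) 1)).encard := by
  have e : zeros H N (Ioc (√2 / 2) 1) =
      yOf '' zeros (1 - H) (N + 1 - 2 * H) (Ico (√2 / 2) 1) := by
    ext x
    constructor
    · rintro ⟨⟨h1, h2⟩, h3⟩
      refine ⟨yOf x, ⟨⟨?_, ?_⟩, ?_⟩, yOf_yOf x⟩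
      · rw [← yOf_one]; exact yOf_strictAnti.antitone h2
      · rw [← yOf_sqrt_two_half]; exact yOf_strictAnti h1
      · rw [← power_swap, yOf_yOf]; exact h3
    · rintro ⟨z, ⟨⟨h1, h2⟩, h3⟩, rfl⟩
      refine ⟨⟨?_, ?_⟩, ?_⟩
      · rw [← yOf_one]; exact yOf_strictAnti h2
      · rw [← yOf_sqrt_two_half]; exact yOf_strictAnti.antitone h1
      · rw [power_swap]; exact h3
  rw [e]
  exact yOf_strictAnti.injective.encard_image _

/-! ### Zeros of a function that falls and then rises. -/

lemma power_lt_left {H N x z : ℝ} (hx : √2 / 2 ≤ x) (hxz : x < z) (hz : z ≤ 1)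
    (h : envAbs z ≤ H) : power H N z < power H N x :=
  power_strictAntiOn ⟨hx.trans hxz.le, hz⟩ h ⟨hx, hxz.le⟩ ⟨hx.trans hxz.le, le_rfl⟩ hxz

lemma power_lt_right {H N x z : ℝ} (hx : √2 / 2 ≤ x) (hxz : x < z) (hz : z ≤ 1)
    (h : H ≤ envAbs x) : power H N x < power H N z :=
  power_strictMonoOn ⟨hx, hxz.le.trans hz⟩ h ⟨le_rfl, hxz.le.trans hz⟩ ⟨hxz.le, hz⟩ hxz

/-- Both ends negative: the power is negative in between. -/
lemma zeros_eq_of_nonpos {H N : ℝ} (h0 : power H N (√2 / 2) ≤ 0) (h1 : power H N 1 ≤ 0) :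
    (zeros H N (Ico (√2 / 2) 1)).encard = if N = 1 then 1 else 0 := by
  have ha : power H N (√2 / 2) = 0 ↔ N = 1 := by rw [power_sqrt_two_half, sub_eq_zero]
  have key : ∀ x ∈ zeros H N (Ico (√2 / 2) 1), x = √2 / 2 := by
    rintro x ⟨⟨hx0, hx1⟩, hx⟩
    by_contra hc
    have hlt := lt_of_le_of_ne' hx0 hc
    rcases le_total (envAbs x) H with h | h
    · linarith [power_lt_left (N := N) le_rfl hlt hx1.le h]
    · linarith [power_lt_right (N := N) hx0 hx1 le_rfl h]
  split_ifs with h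
  · rw [encard_eq_one]
    refine ⟨√2 / 2, Subset.antisymm key (singleton_subset_iff.2 ⟨⟨le_rfl, ?_⟩, ha.2 h⟩)⟩
    linarith [sqrt_two_half_lt]
  · rw [encard_eq_zero, eq_empty_iff_forall_notMem]
    intro x hx
    have := key x hx
    rw [this] at hx
    exact h (ha.1 hx.2)

lemma encard_zeros_of_sign_change {H N : ℝ} (h0 : 0 ≤ power H N (√2 / 2))
    (h1 : power H N 1 < 0) : (zeros H N (Icc (√2 / 2) 1)).encard = 1 := by
  obtain ⟨x, hx, hx0⟩ := intermediate_value_Icc' sqrt_two_half_le_one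
    (continuous_power H N).continuousOn ⟨h1.le, h0⟩
  have uniq : ∀ u ∈ zeros H N (Icc (√2 / 2) 1), ∀ v ∈ zeros H N (Icc (√2 / 2) 1), ¬ u < v := by
    rintro u ⟨hu, hu0⟩ v ⟨hv, hv0⟩ huv
    rcases le_total (envAbs v) H with h | h
    · linarith [power_lt_left (N := N) hu.1 huv hv.2 h]
    · rcases hv.2.eq_or_lt with rfl | h2
      · linarith
      · linarith [power_lt_right (N := N) hv.1 h2 le_rfl h]
  rw [encard_eq_one]
  refine ⟨x, Subset.antisymm (fun z hz => ?_) (singleton_subset_iff.2 ⟨hx, hx0⟩)⟩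
  exact le_antisymm (not_lt.1 (uniq x ⟨hx, hx0⟩ z hz)) (not_lt.1 (uniq z hz x ⟨hx, hx0⟩))

/-- A zero at the turning point is the value of a strict minimum. -/
lemma zeros_of_tangent {H N x : ℝ} (hx : x ∈ zeros H N (Icc (√2 / 2) 1))
    (h : H = envAbs x) : zeros H N (Icc (√2 / 2) 1) = {x} := by
  refine Subset.antisymm (fun z hz => ?_) (singleton_subset_iff.2 hx)
  by_contra hc
  have h1 := hx.2
  have h2 := hz.2
  rcases lt_or_gt_of_ne hc with h3 | h3
  · linarith [power_lt_left (N := N) hz.1.1 h3 hx.1.2 h.ge]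
  · linarith [power_lt_right (N := N) hx.1.1 h3 hz.1.2 h.le]

/-- This guarantees a falling branch for every abscissa `H ≥ 1/2`. -/
lemma envAbs_sqrt_two_half : envAbs (√2 / 2) < 1 / 2 := by
  have h := sqrt_two_half_sq
  have h1 : envAbs (√2 / 2) = 1 / 2 - (1 - √2 / 2) ^ 2 := by
    unfold envAbs
    rw [yOf_sqrt_two_half]
    have e1 : 6 * (√2 / 2 + 1 - 1) ^ 2 - 1 = 2 := by linear_combination 6 * h
    have e2 : -2 * (√2 / 2 + 1 - 1) ^ 3 + 6 * (√2 / 2 + 1 - 1) ^ 2 - (√2 / 2 + 1 - 1) - 1 =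
        2 * (1 - √2 / 2) := by linear_combination (6 - 2 * (√2 / 2)) * h
    rw [e1, e2]; ring
  have := sqrt_two_half_lt
  rw [h1]
  nlinarith

lemma exists_envAbs_eq {H x : ℝ} (hH : 1 / 2 ≤ H) (hx : x ∈ Icc (√2 / 2) 1) (h : H < envAbs x) :
    ∃ z, √2 / 2 < z ∧ z < x ∧ envAbs z = H := by
  obtain ⟨z, hz, he⟩ := intermediate_value_Icc hx.1 continuous_envAbs.continuousOn
    ⟨envAbs_sqrt_two_half.le.trans hH, h.le⟩
  refine ⟨z, hz.1.lt_of_ne ?_, hz.2.lt_of_ne ?_, he⟩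
  · rintro rfl; linarith [envAbs_sqrt_two_half]
  · rintro rfl; linarith

/-- A zero on the rising branch makes the minimum negative, and the nonnegative left end value
forces a second zero on the falling branch. -/
lemma zeros_of_transverse {H N x : ℝ} (hH : 1 / 2 ≤ H) (h0 : 0 ≤ power H N (√2 / 2))
    (hx : x ∈ zeros H N (Icc (√2 / 2) 1)) (h : H < envAbs x) :
    ∃ x₀ < x, zeros H N (Icc (√2 / 2) 1) = {x₀, x} := by
  obtain ⟨z, hz0, hzx, he⟩ := exists_envAbs_eq hH hx.1 h
  have hx0 := hx.2
  have hz1 : z ≤ 1 := hzx.le.trans hx.1.2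
  have hz : power H N z < 0 := by
    linarith [power_lt_right (N := N) hz0.le hzx hx.1.2 he.ge]
  obtain ⟨u, hu, hu0⟩ := intermediate_value_Icc' hz0.le
    (continuous_power H N).continuousOn ⟨hz.le, h0⟩
  refine ⟨u, hu.2.trans_lt hzx, Subset.antisymm ?_ ?_⟩
  · rintro w ⟨hw, hw0⟩
    rcases le_total w z with hwz | hwz
    · left
      exact (power_strictAntiOn ⟨hz0.le, hz1⟩ he.le).injOn ⟨hw.1, hwz⟩ hu (hw0.trans hu0.symm)
    · right
      exact (power_strictMonoOn ⟨hz0.le, hz1⟩ he.ge).injOn ⟨hwz, hw.2⟩ ⟨hzx.le, hx.1.2⟩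
        (hw0.trans hx0.symm)
  · rintro w (rfl | rfl)
    · exact ⟨⟨hu.1, hu.2.trans hz1⟩, hu0⟩
    · exact hx

/-- A zero strictly before `1` on the falling branch makes `power` negative later, so a nonnegative
value at `1` would produce a zero on the rising branch. -/
lemma zeros_subset_of_no_increasing {H N : ℝ} (hH : 1 / 2 ≤ H) (h1 : 0 ≤ power H N 1)
    (h : ∀ x ∈ zeros H N (Icc (√2 / 2) 1), envAbs x < H) :
    zeros H N (Icc (√2 / 2) 1) ⊆ {1} := by
  rintro x ⟨hx, hx0⟩
  by_contra hc
  have hx1 : x < 1 := hx.2.lt_of_ne hc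
  rcases le_or_gt (envAbs 1) H with h2 | h2
  · linarith [power_lt_left (N := N) hx.1 hx1 le_rfl h2]
  · obtain ⟨z, hz0, hz1, he⟩ := exists_envAbs_eq hH ⟨sqrt_two_half_le_one, le_rfl⟩ h2
    have hxz : x < z := by
      by_contra hzx
      have h3 := envAbs_strictMonoOn.monotoneOn ⟨hz0.le, hz1.le⟩ hx (not_lt.1 hzx)
      linarith [h x ⟨hx, hx0⟩]
    have hz : power H N z ≤ 0 := by
      linarith [power_lt_left (N := N) hx.1 hxz hz1.le he.le]
    obtain ⟨u, hu, hu0⟩ := intermediate_value_Icc hz1.le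
      (continuous_power H N).continuousOn ⟨hz, h1⟩
    have h3 := envAbs_strictMonoOn.monotoneOn ⟨hz0.le, hz1.le⟩
      ⟨hz0.le.trans hu.1, hu.2⟩ hu.1
    linarith [h u ⟨⟨hz0.le.trans hu.1, hu.2⟩, hu0⟩]

/-- The number of circles, for the three sides of a triangle with vertices `(0, 0)`, `(1, 0)`,
`(h, t)`, counted without repetition. -/
def total (h t : ℝ) : ℕ∞ :=
  (zeros h (h ^ 2 + t ^ 2) (Ioc (√2 / 2) 1)).encard +
  (zeros (1 + (h - 1) / ((h - 1) ^ 2 + t ^ 2)) ((h ^ 2 + t ^ 2) / ((h - 1) ^ 2 + t ^ 2))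
    (Ico (√2 / 2) 1)).encard +
  (zeros (h / (h ^ 2 + t ^ 2)) (1 / (h ^ 2 + t ^ 2)) (Ico (√2 / 2) 1)).encard

lemma total_cases {h t h' t' : ℝ} (hh : 1 / 2 ≤ h) (ht : 0 < t) (hA : 1 ≤ h ^ 2 + t ^ 2)
    (hB : (h - 1) ^ 2 + t ^ 2 ≤ 1) (hh' : h' = 1 + (h - 1) / ((h - 1) ^ 2 + t ^ 2))
    (ht' : t' = t / ((h - 1) ^ 2 + t ^ 2)) :
    (!₂[h', t'] ∈ F '' D2 \ F '' J0 → total h t = 3) ∧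
    (!₂[h', t'] ∈ F '' J0 ∧ !₂[h', t'] ≠ I1 → total h t = 2) ∧
    (!₂[h', t'] ∉ F '' D2 ∨ !₂[h', t'] = I1 → total h t = 1) := by
  set ρ := (h - 1) ^ 2 + t ^ 2 with hρ
  have hρ0 : 0 < ρ := by positivity
  have hN0 : 0 < h ^ 2 + t ^ 2 := by positivity
  have hNρ : h ^ 2 + t ^ 2 = ρ + 2 * h - 1 := by rw [hρ]; ring
  have hN' : (h ^ 2 + t ^ 2) / ρ = h' ^ 2 + t' ^ 2 := by
    rw [hh', ht']; field_simp; rw [hρ]; ring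
  have ht0' : 0 < t' := by rw [ht']; positivity
  -- Equivalent to `h² + t² ≥ 1`.
  have hhalf : 1 / 2 ≤ h' := by
    have : h' = (ρ + h - 1) / ρ := by rw [hh']; field_simp; ring
    rw [this, le_div_iff₀ hρ0]; linarith
  have hI1 : ∀ {x}, x ∈ zeros h' (h' ^ 2 + t' ^ 2) (Icc (√2 / 2) 1) → h' = envAbs x →
      (!₂[h', t'] = I1 ↔ x = 1) := by
    intro x hx he
    rw [eq_I1_iff ht0']
    constructor
    · rintro ⟨-, h1⟩
      exact envAbs_strictMonoOn.injOn hx.1 ⟨sqrt_two_half_le_one, le_rfl⟩ (he ▸ h1)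
    · rintro rfl; exact ⟨hx.2, he⟩
  rw [mem_sdiff, mem_F_D2 hhalf ht0', mem_F_J0 hhalf ht0']
  have p0' : 0 ≤ power h' (h' ^ 2 + t' ^ 2) (√2 / 2) := by
    rw [power_sqrt_two_half, ← hN', sub_nonneg, le_div_iff₀ hρ0]; linarith
  have q1 : power h' (h' ^ 2 + t' ^ 2) 1 = 1 / ρ - 1 := by
    rw [power_one, ← hN', hh', hNρ]; field_simp; ring
  have p1' : 0 ≤ power h' (h' ^ 2 + t' ^ 2) 1 := by
    rw [q1, sub_nonneg, le_div_iff₀ hρ0]; linarith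
  have third : (zeros (h / (h ^ 2 + t ^ 2)) (1 / (h ^ 2 + t ^ 2)) (Ico (√2 / 2) 1)).encard =
      if h ^ 2 + t ^ 2 = 1 then 1 else 0 := by
    rw [zeros_eq_of_nonpos]
    · simp only [div_eq_one_iff_eq hN0.ne', eq_comm]
    · rw [power_sqrt_two_half, sub_nonpos, div_le_iff₀ hN0]; linarith
    · rw [power_one, sub_nonpos, mul_div_assoc', div_le_div_iff_of_pos_right hN0]; linarith
  -- The longest side contributes 1 exactly when `h² + t² = 1`, which replaces the endpoint `√2/2`
  -- missing from the first count. The endpoint `1` missing from the count for `C'` is a zero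
  -- exactly when `ρ = 1`.
  have tot : total h t + (if ρ = 1 then 1 else 0) =
      (zeros h (h ^ 2 + t ^ 2) (Icc (√2 / 2) 1)).encard +
      (zeros h' (h' ^ 2 + t' ^ 2) (Icc (√2 / 2) 1)).encard := by
    have e : (h' ^ 2 + t' ^ 2 = 2 * h') ↔ ρ = 1 := by
      rw [← sub_eq_zero, ← power_one, q1, sub_eq_zero, div_eq_one_iff_eq hρ0.ne', eq_comm]
    rw [← encard_zeros_Ioc, ← encard_zeros_Ico h', total, third, ← hρ, ← hh', hN']
    simp only [e]
    ring
  rcases hB.lt_or_eq with hlt | heq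
  · have first : (zeros h (h ^ 2 + t ^ 2) (Icc (√2 / 2) 1)).encard = 1 := by
      apply encard_zeros_of_sign_change
      · rw [power_sqrt_two_half]; linarith
      · rw [power_one]; linarith
    have p1 : 0 < power h' (h' ^ 2 + t' ^ 2) 1 := by
      rw [q1, sub_pos, lt_div_iff₀ hρ0]; linarith
    rw [if_neg hlt.ne, add_zero, first] at tot
    rw [tot]
    refine ⟨?_, ?_, ?_⟩
    · rintro ⟨⟨x, hx, hx0, hle⟩, hn⟩
      obtain ⟨u, hu, hz⟩ := zeros_of_transverse hhalf p0' ⟨hx, hx0⟩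
        (hle.lt_of_ne fun he => hn ⟨x, hx, hx0, he⟩)
      rw [hz, encard_pair hu.ne]; norm_num
    · rintro ⟨⟨x, hx, hx0, he⟩, -⟩
      rw [zeros_of_tangent ⟨hx, hx0⟩ he, encard_singleton]; norm_num
    · intro hor
      have hn : ¬ ∃ x ∈ Icc (√2 / 2) 1, power h' (h' ^ 2 + t' ^ 2) x = 0 ∧ h' ≤ envAbs x := by
        rcases hor with h1 | h1
        · exact h1
        · rw [eq_I1_iff ht0'] at h1
          exact absurd h1.1 p1.ne'
      have hsub := zeros_subset_of_no_increasing hhalf p1' fun x hx => by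
        by_contra hc
        exact hn ⟨x, hx.1, hx.2, not_lt.1 hc⟩
      have : zeros h' (h' ^ 2 + t' ^ 2) (Icc (√2 / 2) 1) = ∅ := by
        rw [eq_empty_iff_forall_notMem]
        intro x hx
        have h1 : x = 1 := hsub hx
        rw [h1] at hx
        exact p1.ne' hx.2
      rw [this, encard_empty, add_zero]
  -- For `ρ = 1` the inversion fixes `C`, both counts agree and contain the zero `1`. The total is
  -- twice the common count minus one, hence 1 or 3; tangency occurs only at `x = 1`, that is, at
  -- `I1`.
  · have e1 : h' = h := by rw [hh', heq]; ring
    have e2 : t' = t := by rw [ht', heq]; ring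
    have hz1 : (1 : ℝ) ∈ zeros h' (h' ^ 2 + t' ^ 2) (Icc (√2 / 2) 1) := by
      refine ⟨⟨sqrt_two_half_le_one, le_rfl⟩, ?_⟩
      rw [q1, heq]; norm_num
    rw [if_pos heq, ← e1, ← e2] at tot
    rw [← e1, ← e2]
    have one : zeros h' (h' ^ 2 + t' ^ 2) (Icc (√2 / 2) 1) = {1} → total h' t' = 1 := by
      intro h1
      rw [h1, encard_singleton] at tot
      exact (ENat.add_left_injective_of_ne_top (n := 1) (by simp)) tot
    refine ⟨?_, ?_, ?_⟩
    · rintro ⟨⟨x, hx, hx0, hle⟩, hn⟩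
      have hlt : h' < envAbs x := hle.lt_of_ne fun he => hn ⟨x, hx, hx0, he⟩
      obtain ⟨u, hu, hz⟩ := zeros_of_transverse hhalf p0' ⟨hx, hx0⟩ hlt
      rw [hz, encard_pair hu.ne] at tot
      have h4 : total h' t' + 1 = 3 + 1 := by rw [tot]; norm_num
      exact (ENat.add_left_injective_of_ne_top (n := 1) (by simp)) h4
    · rintro ⟨⟨x, hx, hx0, he⟩, hne⟩
      have h2 := zeros_of_tangent ⟨hx, hx0⟩ he
      rw [h2] at hz1
      have h3 : (1 : ℝ) = x := hz1
      exact absurd ((hI1 ⟨hx, hx0⟩ he).2 h3.symm) hne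
    · rintro (hn | hI)
      · refine one (Subset.antisymm (zeros_subset_of_no_increasing hhalf p1' fun x hx => ?_)
          (singleton_subset_iff.2 hz1))
        by_contra hc
        exact hn ⟨x, hx.1, hx.2, not_lt.1 hc⟩
      · exact one (zeros_of_tangent hz1 ((eq_I1_iff ht0').1 hI).2)

/-! ### Areas cut off by lines -/

lemma affine_apply_eq (b : AffineBasis (Fin 3) ℝ Plane) (f : Plane →ᵃ[ℝ] ℝ) (i : Fin 3)
    (z : Plane) : f z = b.coord i z * f (b i) + b.coord (i + 1) z * f (b (i + 1)) +
      b.coord (i + 2) z * f (b (i + 2)) := by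
  have h : f z = ∑ j, b.coord j z * f (b j) := by
    conv_lhs => rw [← b.affineCombination_coord_eq_self z]
    rw [Finset.map_affineCombination _ _ _ (b.sum_coord_apply_eq_one z),
      Finset.affineCombination_eq_linear_combination _ _ _ (b.sum_coord_apply_eq_one z)]
    simp
  rw [h, Fin.sum_univ_three]
  fin_cases i <;> simp <;> ring

lemma coord_sum (b : AffineBasis (Fin 3) ℝ Plane) (i : Fin 3) (z : Plane) :
    b.coord i z + b.coord (i + 1) z + b.coord (i + 2) z = 1 := by
  have := affine_apply_eq b (AffineMap.const ℝ Plane (1 : ℝ)) i z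
  simpa using this.symm

lemma forall_fin_three (i : Fin 3) (p : Fin 3 → Prop) :
    (∀ j, p j) ↔ p i ∧ p (i + 1) ∧ p (i + 2) := by
  rw [Fin.forall_fin_succ, Fin.forall_fin_two]
  fin_cases i <;> simp <;> tauto

lemma add_one_ne (i : Fin 3) : i + 1 ≠ i ∧ i + 2 ≠ i ∧ i + 2 ≠ i + 1 := by
  fin_cases i <;> decide

lemma volume_line (f : Plane →ᵃ[ℝ] ℝ) {w : Plane} (hw : f w ≠ 0) :
    volume {z | f z = 0} = 0 := by
  have h := Measure.addHaar_affineSubspace (volume : Measure Plane)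
    ((AffineSubspace.mk' (0 : ℝ) ⊥).comap f) (by
      intro h
      have : w ∈ (AffineSubspace.mk' (0 : ℝ) ⊥).comap f := h ▸ AffineSubspace.mem_top ℝ Plane w
      simp [AffineSubspace.mem_mk'] at this
      exact hw this)
  convert h using 2
  ext z
  simp [AffineSubspace.mem_mk']

lemma ae_ne_zero (f : Plane →ᵃ[ℝ] ℝ) {w : Plane} (hw : f w ≠ 0) :
    ∀ᵐ z ∂(volume : Measure Plane), f z ≠ 0 := by
  rw [ae_iff]; simpa using volume_line f hw

/-- The closed triangle with vertices `b i`. -/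
def hull (b : AffineBasis (Fin 3) ℝ Plane) : Set Plane := convexHull ℝ (range b)

lemma mem_hull (b : AffineBasis (Fin 3) ℝ Plane) (i : Fin 3) {z : Plane} : z ∈ hull b ↔
    0 ≤ b.coord i z ∧ 0 ≤ b.coord (i + 1) z ∧ 0 ≤ b.coord (i + 2) z := by
  rw [hull, b.convexHull_eq_nonneg_coord]
  exact forall_fin_three i _

lemma convex_hull (b : AffineBasis (Fin 3) ℝ Plane) : Convex ℝ (hull b) := convex_convexHull _ _

lemma isCompact_hull (b : AffineBasis (Fin 3) ℝ Plane) : IsCompact (hull b) :=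
  (finite_range b).isCompact_convexHull ℝ

lemma volume_hull_ne_top (b : AffineBasis (Fin 3) ℝ Plane) : volume (hull b) ≠ ⊤ :=
  (isCompact_hull b).measure_lt_top.ne

lemma volume_hull_pos (b : AffineBasis (Fin 3) ℝ Plane) : 0 < volume.real (hull b) := by
  refine ENNReal.toReal_pos (ne_of_gt ?_) (volume_hull_ne_top b)
  exact Measure.measure_pos_of_nonempty_interior _ ⟨_, b.centroid_mem_interior_convexHull⟩

/-- Edge vectors from the first vertex. -/
def edgeBasis (b : AffineBasis (Fin 3) ℝ Plane) : Module.Basis (Fin 2) ℝ Plane :=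
  (b.basisOf 0).reindex (finSuccAboveEquiv (0 : Fin 3)).symm

lemma edgeBasis_apply (b : AffineBasis (Fin 3) ℝ Plane) (j : Fin 2) :
    edgeBasis b j = b j.succ - b 0 := by
  simp [edgeBasis, finSuccAboveEquiv]

/-- The functions `f`, `g`, `k` act as barycentric coordinates of the region, so an affine map with
linear determinant `d` carries it onto the triangle. -/
lemma volume_subtriangle_zero (b : AffineBasis (Fin 3) ℝ Plane) (f g k : Plane →ᵃ[ℝ] ℝ)
    (hs : ∀ z, f z + g z + k z = 1) {d : ℝ} (hd : d = (f (b 1) - f (b 0)) * (g (b 2) - g (b 0)) -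
      (f (b 2) - f (b 0)) * (g (b 1) - g (b 0))) (hd0 : d ≠ 0) :
    volume.real {z | 0 ≤ f z ∧ 0 ≤ g z ∧ 0 ≤ k z} = volume.real (hull b) / |d| := by
  set v₁ := b 1 - b 0 with hv₁
  set v₂ := b 2 - b 0 with hv₂
  let L : Plane →ₗ[ℝ] Plane := f.linear.smulRight v₁ + g.linear.smulRight v₂
  have hdet : LinearMap.det L = d := by
    rw [← LinearMap.det_toMatrix (edgeBasis b), Matrix.det_fin_two]
    have key : ∀ j, L (edgeBasis b j) =
        f.linear (edgeBasis b j) • edgeBasis b 0 + g.linear (edgeBasis b j) • edgeBasis b 1 := by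
      intro j; simp [L, edgeBasis_apply, hv₁, hv₂]
    have hf : ∀ j, f.linear (edgeBasis b j) = f (b j.succ) - f (b 0) := by
      intro j; rw [edgeBasis_apply]; exact f.linearMap_vsub _ _
    have hg : ∀ j, g.linear (edgeBasis b j) = g (b j.succ) - g (b 0) := by
      intro j; rw [edgeBasis_apply]; exact g.linearMap_vsub _ _
    simp only [LinearMap.toMatrix_apply, key, hf, hg]
    simp [hd]
  let φ : Plane → Plane := fun z => L z + (b 0 + f 0 • v₁ + g 0 • v₂)
  have hφ : ∀ z, φ z = b 0 + f z • v₁ + g z • v₂ := by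
    intro z
    have h1 : f z = f.linear z + f 0 := by
      have := f.linearMap_vsub z 0
      simp at this; linarith
    have h2 : g z = g.linear z + g 0 := by
      have := g.linearMap_vsub z 0
      simp at this; linarith
    simp only [φ, L, h1, h2, LinearMap.add_apply, LinearMap.smulRight_apply, add_smul]
    abel
  have hcoord : ∀ j z, b.coord j (φ z) = b.coord j (b 0) + f z * (b.coord j (b 1) - b.coord j (b 0))
      + g z * (b.coord j (b 2) - b.coord j (b 0)) := by
    intro j z
    have e1 : (b.coord j).linear v₁ = b.coord j (b 1) - b.coord j (b 0) :=
      (b.coord j).linearMap_vsub _ _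
    have e2 : (b.coord j).linear v₂ = b.coord j (b 2) - b.coord j (b 0) :=
      (b.coord j).linearMap_vsub _ _
    rw [← e1, ← e2, hφ]
    have : b 0 + f z • v₁ + g z • v₂ = (f z • v₁ + g z • v₂) +ᵥ b 0 := by
      rw [vadd_eq_add]; abel
    rw [this, AffineMap.map_vadd]
    simp only [map_add, map_smul, smul_eq_mul, vadd_eq_add]; ring
  have hpre : {z | 0 ≤ f z ∧ 0 ≤ g z ∧ 0 ≤ k z} =
      L ⁻¹' ((fun w => w + (b 0 + f 0 • v₁ + g 0 • v₂)) ⁻¹' hull b) := by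
    ext z
    change _ ↔ φ z ∈ hull b
    rw [mem_hull b 0, hcoord, hcoord, hcoord]
    have := hs z
    simp [b.coord_apply]
    constructor
    · rintro ⟨h1, h2, h3⟩; exact ⟨by linarith, h1, h2⟩
    · rintro ⟨h1, h2, h3⟩; exact ⟨h2, h3, by linarith⟩
  rw [hpre, measureReal_def, Measure.addHaar_preimage_linearMap _ (by rwa [hdet]),
    measure_preimage_add_right, hdet, ENNReal.toReal_mul, ENNReal.toReal_ofReal (abs_nonneg _),
    measureReal_def, abs_inv]
  ring

/-- The basis with its indices rotated by `i`. -/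
def rot (b : AffineBasis (Fin 3) ℝ Plane) (i : Fin 3) : AffineBasis (Fin 3) ℝ Plane :=
  b.reindex (Equiv.addLeft i).symm

lemma rot_apply (b : AffineBasis (Fin 3) ℝ Plane) (i j : Fin 3) : rot b i j = b (i + j) := rfl

lemma hull_rot (b : AffineBasis (Fin 3) ℝ Plane) (i : Fin 3) : hull (rot b i) = hull b := by
  unfold hull rot
  rw [b.coe_reindex, EquivLike.range_comp]

lemma volume_subtriangle (b : AffineBasis (Fin 3) ℝ Plane) (i : Fin 3) (f g k : Plane →ᵃ[ℝ] ℝ)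
    (hs : ∀ z, f z + g z + k z = 1) {d : ℝ} (hd : d = (f (b (i + 1)) - f (b i)) *
      (g (b (i + 2)) - g (b i)) - (f (b (i + 2)) - f (b i)) * (g (b (i + 1)) - g (b i)))
    (hd0 : d ≠ 0) :
    volume.real {z | 0 ≤ f z ∧ 0 ≤ g z ∧ 0 ≤ k z} = volume.real (hull b) / |d| := by
  rw [← hull_rot b i]
  exact volume_subtriangle_zero (rot b i) f g k hs (by simpa [rot_apply] using hd) hd0

/-- The part of `K` in the open half plane `f > 0`. -/
def half (K : Set Plane) (f : Plane →ᵃ[ℝ] ℝ) : Set Plane := {z ∈ K | 0 < f z}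

/-- The part of `K` in the open quadrant `f > 0`, `g > 0`. -/
def cut (K : Set Plane) (f g : Plane →ᵃ[ℝ] ℝ) : Set Plane := {z ∈ K | 0 < f z ∧ 0 < g z}

lemma cut_comm (K : Set Plane) (f g : Plane →ᵃ[ℝ] ℝ) : cut K f g = cut K g f := by
  ext z; simp [cut, and_comm]

lemma measurableSet_pos (f : Plane →ᵃ[ℝ] ℝ) : MeasurableSet {z | 0 < f z} :=
  (isOpen_lt continuous_const f.continuous_of_finiteDimensional).measurableSet

lemma measurableSet_hull (b : AffineBasis (Fin 3) ℝ Plane) : MeasurableSet (hull b) :=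
  (isCompact_hull b).isClosed.measurableSet

lemma measurableSet_cut (b : AffineBasis (Fin 3) ℝ Plane) (f g : Plane →ᵃ[ℝ] ℝ) :
    MeasurableSet (cut (hull b) f g) :=
  (measurableSet_hull b).inter ((measurableSet_pos f).inter (measurableSet_pos g))

lemma measurableSet_half (b : AffineBasis (Fin 3) ℝ Plane) (f : Plane →ᵃ[ℝ] ℝ) :
    MeasurableSet (half (hull b) f) :=
  (measurableSet_hull b).inter (measurableSet_pos f)

lemma volume_ne_top_of_subset_hull (b : AffineBasis (Fin 3) ℝ Plane) {s : Set Plane}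
    (h : s ⊆ hull b) : volume s ≠ ⊤ :=
  measure_ne_top_of_subset h (volume_hull_ne_top b)

lemma half_eq_add (b : AffineBasis (Fin 3) ℝ Plane) (f g : Plane →ᵃ[ℝ] ℝ) {w : Plane}
    (hw : g w ≠ 0) : volume.real (half (hull b) f) =
      volume.real (cut (hull b) f g) + volume.real (cut (hull b) f (-g)) := by
  rw [← measureReal_union _ (measurableSet_cut b f (-g))
    (volume_ne_top_of_subset_hull b fun z hz => hz.1)
    (volume_ne_top_of_subset_hull b fun z hz => hz.1)]
  · apply measureReal_congr
    filter_upwards [ae_ne_zero g hw] with z hz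
    apply propext
    change (z ∈ hull b ∧ 0 < f z) ↔ (z ∈ hull b ∧ 0 < f z ∧ 0 < g z) ∨
      (z ∈ hull b ∧ 0 < f z ∧ 0 < -g z)
    rw [neg_pos]
    have := lt_or_gt_of_ne hz
    tauto
  · rw [Set.disjoint_left]
    rintro z ⟨-, -, h1⟩ ⟨-, -, h2⟩
    change 0 < -g z at h2
    linarith

lemma hull_eq_add (b : AffineBasis (Fin 3) ℝ Plane) (f : Plane →ᵃ[ℝ] ℝ) {w : Plane}
    (hw : f w ≠ 0) : volume.real (hull b) =
      volume.real (half (hull b) f) + volume.real (half (hull b) (-f)) := by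
  rw [← measureReal_union _ (measurableSet_half b (-f))
    (volume_ne_top_of_subset_hull b fun z hz => hz.1)
    (volume_ne_top_of_subset_hull b fun z hz => hz.1)]
  · apply measureReal_congr
    filter_upwards [ae_ne_zero f hw] with z hz
    apply propext
    change z ∈ hull b ↔ (z ∈ hull b ∧ 0 < f z) ∨ (z ∈ hull b ∧ 0 < -f z)
    rw [neg_pos]
    have := lt_or_gt_of_ne hz
    tauto
  · rw [Set.disjoint_left]
    rintro z ⟨-, h1⟩ ⟨-, h2⟩
    change 0 < -f z at h2
    linarith

/-- The two lines cut the triangle into four parts of the same area. -/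
structure Quarters (b : AffineBasis (Fin 3) ℝ Plane) (f g : Plane →ᵃ[ℝ] ℝ) : Prop where
  pp : volume.real (cut (hull b) f g) = volume.real (hull b) / 4
  pn : volume.real (cut (hull b) f (-g)) = volume.real (hull b) / 4
  np : volume.real (cut (hull b) (-f) g) = volume.real (hull b) / 4
  nn : volume.real (cut (hull b) (-f) (-g)) = volume.real (hull b) / 4

lemma Quarters.symm {b : AffineBasis (Fin 3) ℝ Plane} {f g : Plane →ᵃ[ℝ] ℝ}
    (h : Quarters b f g) : Quarters b g f := by
  refine ⟨?_, ?_, ?_, ?_⟩ <;> rw [cut_comm]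
  exacts [h.pp, h.np, h.pn, h.nn]

lemma Quarters.neg {b : AffineBasis (Fin 3) ℝ Plane} {f g : Plane →ᵃ[ℝ] ℝ}
    (h : Quarters b f g) : Quarters b (-f) g :=
  ⟨h.np, h.nn, by rw [neg_neg]; exact h.pp, by rw [neg_neg]; exact h.pn⟩

lemma cut_smul {K : Set Plane} {f g : Plane →ᵃ[ℝ] ℝ} {c : ℝ} (hc : 0 < c) :
    cut K (c • f) g = cut K f g := by
  ext z; simp [cut, hc]

lemma half_smul {K : Set Plane} {f : Plane →ᵃ[ℝ] ℝ} {c : ℝ} (hc : 0 < c) :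
    half K (c • f) = half K f := by
  ext z; simp [half, hc]

lemma Quarters.of_smul {b : AffineBasis (Fin 3) ℝ Plane} {f g : Plane →ᵃ[ℝ] ℝ} {c : ℝ}
    (hc : c ≠ 0) (h : Quarters b (c • f) g) : Quarters b f g := by
  have pos : ∀ {c : ℝ} {f : Plane →ᵃ[ℝ] ℝ}, 0 < c → Quarters b (c • f) g → Quarters b f g := by
    intro c f hc h
    have := h.pp; have := h.pn; have := h.np; have := h.nn
    simp only [← smul_neg, cut_smul hc] at *
    constructor <;> assumption
  rcases lt_or_gt_of_ne hc with h0 | h0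
  · have h2 := h.neg
    rw [← neg_smul] at h2
    exact pos (neg_pos.2 h0) h2
  · exact pos h0 h

lemma Quarters.exists_ne {b : AffineBasis (Fin 3) ℝ Plane} {f g : Plane →ᵃ[ℝ] ℝ}
    (h : Quarters b f g) : ∃ w ∈ hull b, 0 < f w ∧ 0 < g w := by
  by_contra hc
  have : cut (hull b) f g = ∅ := by
    rw [eq_empty_iff_forall_notMem]
    rintro z ⟨h1, h2⟩
    exact hc ⟨z, h1, h2⟩
  have h1 := h.pp
  rw [this, measureReal_empty] at h1
  linarith [volume_hull_pos b]

lemma Quarters.half_eq {b : AffineBasis (Fin 3) ℝ Plane} {f g : Plane →ᵃ[ℝ] ℝ}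
    (h : Quarters b f g) : volume.real (half (hull b) f) = volume.real (hull b) / 2 := by
  obtain ⟨w, -, -, hw⟩ := h.exists_ne
  rw [half_eq_add b f g hw.ne', h.pp, h.pn]; ring

/-- Two halves and one quarter determine the other three areas by additivity, lines being null sets.
-/
lemma Quarters.of_halves {b : AffineBasis (Fin 3) ℝ Plane} {f g : Plane →ᵃ[ℝ] ℝ}
    (hf : volume.real (half (hull b) f) = volume.real (hull b) / 2)
    (hg : volume.real (half (hull b) g) = volume.real (hull b) / 2)
    (hfg : volume.real (cut (hull b) f g) = volume.real (hull b) / 4) : Quarters b f g := by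
  have hV := volume_hull_pos b
  have ex : ∀ f : Plane →ᵃ[ℝ] ℝ, volume.real (half (hull b) f) = volume.real (hull b) / 2 →
      ∃ w, f w ≠ 0 := by
    intro f hf
    by_contra hc
    push Not at hc
    have : half (hull b) f = ∅ := by
      rw [eq_empty_iff_forall_notMem]
      rintro z ⟨-, h2⟩
      exact h2.ne' (hc z)
    rw [this, measureReal_empty] at hf
    linarith
  obtain ⟨u, hu⟩ := ex f hf
  obtain ⟨w, hw⟩ := ex g hg
  have e1 := half_eq_add b f g hw
  have e2 := half_eq_add b g f hu
  have e3 := half_eq_add b (-f) g hw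
  have e4 := hull_eq_add b f hu
  rw [cut_comm _ g f, cut_comm _ g (-f)] at e2
  constructor <;> linarith

/-- Strict and weak inequalities cut out the same area. -/
lemma cut_ae_eq (b : AffineBasis (Fin 3) ℝ Plane) (f g : Plane →ᵃ[ℝ] ℝ) {u w : Plane}
    (hu : f u ≠ 0) (hw : g w ≠ 0) :
    volume.real (cut (hull b) f g) = volume.real {z ∈ hull b | 0 ≤ f z ∧ 0 ≤ g z} := by
  apply measureReal_congr
  filter_upwards [ae_ne_zero f hu, ae_ne_zero g hw] with z h1 h2
  apply propext
  change (z ∈ hull b ∧ 0 < f z ∧ 0 < g z) ↔ (z ∈ hull b ∧ 0 ≤ f z ∧ 0 ≤ g z)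
  rw [h1.symm.le_iff_lt, h2.symm.le_iff_lt]

lemma half_ae_eq (b : AffineBasis (Fin 3) ℝ Plane) (f : Plane →ᵃ[ℝ] ℝ) {u : Plane}
    (hu : f u ≠ 0) : volume.real (half (hull b) f) = volume.real {z ∈ hull b | 0 ≤ f z} := by
  apply measureReal_congr
  filter_upwards [ae_ne_zero f hu] with z h1
  apply propext
  change (z ∈ hull b ∧ 0 < f z) ↔ (z ∈ hull b ∧ 0 ≤ f z)
  rw [h1.symm.le_iff_lt]

/-- A function which vanishes on the line through the points of the edges at `b i` with edge ratios
`s` and `p`. -/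
def cornerFn (b : AffineBasis (Fin 3) ℝ Plane) (i : Fin 3) (s p : ℝ) : Plane →ᵃ[ℝ] ℝ :=
  b.coord i + (1 - 1 / s) • b.coord (i + 1) + (1 - 1 / p) • b.coord (i + 2)

lemma cornerFn_apply (b : AffineBasis (Fin 3) ℝ Plane) (i : Fin 3) (s p : ℝ) (z : Plane) :
    cornerFn b i s p z =
      b.coord i z + (1 - 1 / s) * b.coord (i + 1) z + (1 - 1 / p) * b.coord (i + 2) z := rfl

lemma cornerFn_self (b : AffineBasis (Fin 3) ℝ Plane) (i : Fin 3) (s p : ℝ) :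
    cornerFn b i s p (b i) = 1 := by
  simp [cornerFn_apply, b.coord_apply]

/-- A bisecting line. -/
def chordFn (b : AffineBasis (Fin 3) ℝ Plane) (i : Fin 3) (s : ℝ) : Plane →ᵃ[ℝ] ℝ :=
  cornerFn b i s (1 / (2 * s))

lemma chordFn_apply (b : AffineBasis (Fin 3) ℝ Plane) (i : Fin 3) (s : ℝ) (z : Plane) :
    chordFn b i s z =
      b.coord i z + (1 - 1 / s) * b.coord (i + 1) z + (1 - 2 * s) * b.coord (i + 2) z := by
  rw [chordFn, cornerFn_apply, one_div_one_div]

lemma chordFn_succ_apply (b : AffineBasis (Fin 3) ℝ Plane) (i : Fin 3) (y : ℝ) (z : Plane) :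
    chordFn b (i + 1) (1 / (2 * y)) z =
      b.coord (i + 1) z + (1 - 2 * y) * b.coord (i + 2) z + (1 - 1 / y) * b.coord i z := by
  have h1 : i + 1 + 1 = i + 2 := by fin_cases i <;> rfl
  have h2 : i + 1 + 2 = i := by fin_cases i <;> rfl
  rw [chordFn_apply, one_div_one_div, h1, h2]
  congr 3
  ring

lemma volume_half_corner (b : AffineBasis (Fin 3) ℝ Plane) (i : Fin 3) {s p : ℝ}
    (hs : s ∈ Ioc 0 1) (hp : p ∈ Ioc 0 1) :
    volume.real (half (hull b) (cornerFn b i s p)) = s * p * volume.real (hull b) := by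
  have hs0 := hs.1
  have hp0 := hp.1
  have e : {z ∈ hull b | 0 ≤ cornerFn b i s p z} = {z | 0 ≤ ((1 / s) • b.coord (i + 1)) z ∧
      0 ≤ ((1 / p) • b.coord (i + 2)) z ∧ 0 ≤ cornerFn b i s p z} := by
    ext z
    have h1 : 1 ≤ 1 / s := (one_le_div hs0).2 hs.2
    have h2 : 1 ≤ 1 / p := (one_le_div hp0).2 hp.2
    simp only [mem_ofPred_eq, mem_hull b i, AffineMap.coe_smul, Pi.smul_apply, smul_eq_mul,
      mul_nonneg_iff_of_pos_left (one_div_pos.2 hs0), mul_nonneg_iff_of_pos_left (one_div_pos.2 hp0)]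
    refine ⟨fun h => ⟨h.1.2.1, h.1.2.2, h.2⟩, fun h => ⟨⟨?_, h.1, h.2.1⟩, h.2.2⟩⟩
    have h3 := h.2.2
    rw [cornerFn_apply] at h3
    nlinarith [mul_nonneg (sub_nonneg.2 h1) h.1, mul_nonneg (sub_nonneg.2 h2) h.2.1]
  rw [half_ae_eq b _ (u := b i) (by rw [cornerFn_self]; exact one_ne_zero), e,
    volume_subtriangle b i _ _ _ (d := 1 / s * (1 / p))]
  · rw [abs_of_pos (by positivity)]; field_simp
  · intro z
    rw [cornerFn_apply]
    simp only [AffineMap.coe_smul, Pi.smul_apply, smul_eq_mul]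
    linear_combination coord_sum b i z
  · simp [b.coord_apply]
  · positivity

lemma chordFn_self (b : AffineBasis (Fin 3) ℝ Plane) (i : Fin 3) (s : ℝ) :
    chordFn b i s (b i) = 1 := cornerFn_self b i _ _

lemma volume_half_chord (b : AffineBasis (Fin 3) ℝ Plane) (i : Fin 3) {s : ℝ}
    (hs : s ∈ Ioc (1 / 2) 1) :
    volume.real (half (hull b) (chordFn b i s)) = volume.real (hull b) / 2 := by
  have h0 : 0 < s := by linarith [hs.1]
  rw [chordFn, volume_half_corner b i ⟨h0, hs.2⟩
    ⟨by positivity, by rw [div_le_one (by positivity)]; linarith [hs.1]⟩]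
  field_simp

/-- The part between the chords is a triangle with base from `s` to `s'` on the edge `i` and apex at
their crossing. -/
lemma volume_cut_same (b : AffineBasis (Fin 3) ℝ Plane) (i : Fin 3) {s s' : ℝ}
    (hs : 1 / 2 < s) (hss : s < s') (hs' : s' ≤ 1) :
    volume.real (cut (hull b) (-chordFn b i s) (chordFn b i s')) =
      (s' - s) / (2 * (s + s')) * volume.real (hull b) := by
  have h0 : 0 < s := by linarith
  have h0' : 0 < s' := by linarith
  have hd : 0 < s' - s := by linarith
  have e : {z ∈ hull b | 0 ≤ (-chordFn b i s) z ∧ 0 ≤ chordFn b i s' z} =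
      {z | 0 ≤ (-(s / (s' - s)) • chordFn b i s) z ∧
        0 ≤ ((2 * (s + s')) • b.coord (i + 2)) z ∧ 0 ≤ ((s' / (s' - s)) • chordFn b i s') z} := by
    ext z
    have c1 : 0 < s / (s' - s) := by positivity
    have c2 : 0 < s' / (s' - s) := by positivity
    have c3 : 0 < 2 * (s + s') := by positivity
    simp only [mem_ofPred_eq, mem_hull b i, AffineMap.coe_smul, AffineMap.coe_neg, Pi.neg_apply,
      Pi.smul_apply, smul_eq_mul, neg_mul, neg_nonneg, mul_nonneg_iff_of_pos_left c2,
      mul_nonneg_iff_of_pos_left c3]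
    rw [← neg_nonneg (a := s / (s' - s) * _), ← mul_neg, mul_nonneg_iff_of_pos_left c1, neg_nonneg]
    refine ⟨fun h => ⟨h.2.1, h.1.2.2, h.2.2⟩, fun h => ⟨?_, h.1, h.2.2⟩⟩
    obtain ⟨h1, h2, h3⟩ := h
    have m1 : 0 ≤ s * -chordFn b i s z := mul_nonneg h0.le (by linarith)
    have m3 : 0 ≤ s' * chordFn b i s' z := mul_nonneg h0'.le h3
    have hsum := coord_sum b i z
    have g1 : s * -chordFn b i s z = b.coord (i + 1) z + 2 * s ^ 2 * b.coord (i + 2) z - s := by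
      rw [chordFn_apply]; field_simp; linear_combination (-s) * hsum
    have g3 : s' * chordFn b i s' z =
        s' - b.coord (i + 1) z - 2 * s' ^ 2 * b.coord (i + 2) z := by
      rw [chordFn_apply]; field_simp; linear_combination s' * hsum
    rw [g1] at m1
    rw [g3] at m3
    -- Barycentric coordinates written as nonnegative combinations of the three defining
    -- inequalities: the region stays inside the triangle.
    have hu : (s' - s) * b.coord (i + 1) z =
        s * (s' - b.coord (i + 1) z - 2 * s' ^ 2 * b.coord (i + 2) z) +
        s' * (b.coord (i + 1) z + 2 * s ^ 2 * b.coord (i + 2) z - s) +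
        2 * s * s' * (s' - s) * b.coord (i + 2) z := by ring
    have hw : (s' - s) * b.coord i z =
        (1 - s) * (s' - b.coord (i + 1) z - 2 * s' ^ 2 * b.coord (i + 2) z) +
        (1 - s') * (b.coord (i + 1) z + 2 * s ^ 2 * b.coord (i + 2) z - s) +
        (s' - s) * (1 - 2 * (1 - s) * (1 - s')) * b.coord (i + 2) z := by
      linear_combination (s' - s) * hsum
    refine ⟨?_, ?_, h2⟩
    · have : 0 ≤ (s' - s) * b.coord i z := by
        rw [hw]
        have : 0 ≤ 1 - 2 * (1 - s) * (1 - s') := by nlinarith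
        have := mul_nonneg (by linarith : 0 ≤ 1 - s) m3
        have := mul_nonneg (by linarith : 0 ≤ 1 - s') m1
        positivity
      exact nonneg_of_mul_nonneg_right this hd
    · have : 0 ≤ (s' - s) * b.coord (i + 1) z := by rw [hu]; positivity
      exact nonneg_of_mul_nonneg_right this hd
  rw [cut_ae_eq b _ _ (u := b i) (w := b i), e,
    volume_subtriangle b i _ _ _ (d := 1 / (s' - s) * (2 * (s + s')))]
  · rw [abs_of_pos (by positivity)]; field_simp
  · intro z
    simp only [AffineMap.coe_smul, Pi.smul_apply, smul_eq_mul]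
    rw [chordFn_apply, chordFn_apply]
    field_simp
    linear_combination (s' - s) * coord_sum b i z
  · simp [chordFn_apply, b.coord_apply]; field_simp; simp
  · positivity
  · simp [chordFn_self]
  · simp [chordFn_self]

/-- Area 1/4 would require `s' = 3s`, impossible for parameters in `(1/2, 1]`. -/
lemma not_quarters_same (b : AffineBasis (Fin 3) ℝ Plane) (i : Fin 3) {s s' : ℝ}
    (hs : s ∈ Ioc (1 / 2) 1) (hs' : s' ∈ Ioc (1 / 2) 1) :
    ¬ Quarters b (chordFn b i s) (chordFn b i s') := by
  have hV := volume_hull_pos b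
  have key : ∀ {s s' : ℝ}, s ∈ Ioc (1 / 2) 1 → s' ∈ Ioc (1 / 2) 1 → s < s' →
      ¬ Quarters b (chordFn b i s) (chordFn b i s') := by
    intro s s' hs hs' hlt h
    have h1 := h.np
    have p1 : 0 < s := by linarith [hs.1]
    have p2 : 0 < s' := by linarith
    rw [volume_cut_same b i hs.1 hlt hs'.2, div_mul_eq_mul_div,
      div_eq_div_iff (by positivity) (by norm_num)] at h1
    have : (s' - s) * 4 = 2 * (s + s') := by
      apply mul_right_cancel₀ hV.ne'; linear_combination h1
    linarith [hs'.2, hs.1]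
  intro h
  rcases lt_trichotomy s s' with h1 | h1 | h1
  · exact key hs hs' h1 h
  · subst h1
    obtain ⟨w, -, h2, h3⟩ := h.neg.exists_ne
    change 0 < -chordFn b i s w at h2
    linarith
  · exact key hs' hs h1 h.symm

/-- The part is a triangle whose base, from `1 - y` to `x` on the edge `i`, has relative length `S`,
and whose relative height is `S / W`. -/
lemma volume_cut_adjacent (b : AffineBasis (Fin 3) ℝ Plane) (i : Fin 3) {x y : ℝ}
    (hx : x ∈ Ioc (1 / 2) 1) (hy : y ∈ Ico (1 / 2) 1) :
    volume.real (cut (hull b) (chordFn b i x) (chordFn b (i + 1) (1 / (2 * y)))) =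
      (x + y - 1) ^ 2 / (2 * x ^ 2 + 2 * y ^ 2 - 1) * volume.real (hull b) := by
  obtain ⟨hx0, hx1⟩ := hx
  obtain ⟨hy0, hy1⟩ := hy
  have hxp : 0 < x := by linarith
  have hyp : 0 < y := by linarith
  have hd : 0 < x + y - 1 := by linarith
  have hW : 0 < 2 * x ^ 2 + 2 * y ^ 2 - 1 := by nlinarith
  set S := x + y - 1 with hS
  set W := 2 * x ^ 2 + 2 * y ^ 2 - 1 with hW'
  have E1 : ∀ z, x * chordFn b i x z = x - b.coord (i + 1) z - 2 * x ^ 2 * b.coord (i + 2) z := by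
    intro z
    rw [chordFn_apply]; field_simp; linear_combination x * coord_sum b i z
  have E2 : ∀ z, y * chordFn b (i + 1) (1 / (2 * y)) z =
      y - 1 + b.coord (i + 1) z + (1 - 2 * y ^ 2) * b.coord (i + 2) z := by
    intro z
    rw [chordFn_succ_apply]; field_simp; linear_combination (y - 1) * coord_sum b i z
  have e : {z ∈ hull b | 0 ≤ chordFn b i x z ∧ 0 ≤ chordFn b (i + 1) (1 / (2 * y)) z} =
      {z | 0 ≤ ((x / S) • chordFn b i x) z ∧ 0 ≤ ((W / S) • b.coord (i + 2)) z ∧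
        0 ≤ ((y / S) • chordFn b (i + 1) (1 / (2 * y))) z} := by
    ext z
    have c1 : 0 < x / S := by positivity
    have c2 : 0 < y / S := by positivity
    have c3 : 0 < W / S := by positivity
    simp only [mem_ofPred_eq, mem_hull b i, AffineMap.coe_smul,
      Pi.smul_apply, smul_eq_mul, mul_nonneg_iff_of_pos_left c1, mul_nonneg_iff_of_pos_left c2,
      mul_nonneg_iff_of_pos_left c3]
    refine ⟨fun h => ⟨h.2.1, h.1.2.2, h.2.2⟩, fun h => ⟨?_, h.1, h.2.2⟩⟩
    obtain ⟨h1, h2, h3⟩ := h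
    have m1 := mul_nonneg hxp.le h1
    have m3 := mul_nonneg hyp.le h3
    have hsum := coord_sum b i z
    have hu : S * b.coord (i + 1) z =
        x * (y * chordFn b (i + 1) (1 / (2 * y)) z) + (1 - y) * (x * chordFn b i x z) +
        x * (2 * x * (1 - y) - (1 - 2 * y ^ 2)) * b.coord (i + 2) z := by
      rw [E1, E2, hS]; ring
    have hw : S * b.coord i z =
        (1 - x) * (y * chordFn b (i + 1) (1 / (2 * y)) z) + y * (x * chordFn b i x z) +
        y * (2 * y * (1 - x) - (1 - 2 * x ^ 2)) * b.coord (i + 2) z := by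
      rw [E1, E2, hS]; linear_combination (x + y - 1) * hsum
    have q1 : 0 ≤ 2 * x * (1 - y) - (1 - 2 * y ^ 2) := by nlinarith
    have q2 : 0 ≤ 2 * y * (1 - x) - (1 - 2 * x ^ 2) := by nlinarith
    have r1 : 0 ≤ 1 - y := by linarith
    have r2 : 0 ≤ 1 - x := by linarith
    refine ⟨?_, ?_, h2⟩
    · refine nonneg_of_mul_nonneg_right (a := S) ?_ hd
      rw [hw]; positivity
    · refine nonneg_of_mul_nonneg_right (a := S) ?_ hd
      rw [hu]; positivity
  rw [cut_ae_eq b _ _ (u := b i) (w := b (i + 1)), e,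
    volume_subtriangle b i _ _ _ (d := -(1 / S * (W / S)))]
  · rw [abs_neg, abs_of_pos (by positivity)]; field_simp
  · intro z
    simp only [AffineMap.coe_smul, Pi.smul_apply, smul_eq_mul]
    have h1 := E1 z
    have h2 := E2 z
    generalize chordFn b (i + 1) (1 / (2 * y)) z = G at h2 ⊢
    field_simp
    rw [h1, h2, hW', hS]; ring
  · simp [chordFn_apply, b.coord_apply]; field_simp; simp
  · exact neg_ne_zero.2 (by positivity)
  · simp [chordFn_self]
  · simp [chordFn_self]

lemma quarters_adjacent_iff (b : AffineBasis (Fin 3) ℝ Plane) (i : Fin 3) {x y : ℝ}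
    (hx : x ∈ Ioc (1 / 2) 1) (hy : y ∈ Ico (1 / 2) 1) :
    Quarters b (chordFn b i x) (chordFn b (i + 1) (1 / (2 * y))) ↔
      4 * (x + y - 1) ^ 2 = 2 * x ^ 2 + 2 * y ^ 2 - 1 := by
  have hV := volume_hull_pos b
  have hW : 0 < 2 * x ^ 2 + 2 * y ^ 2 - 1 := by nlinarith [hx.1, hy.1]
  have hvol := volume_cut_adjacent b i hx hy
  constructor
  · intro h
    have h1 : (x + y - 1) ^ 2 / (2 * x ^ 2 + 2 * y ^ 2 - 1) = 1 / 4 := by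
      apply mul_right_cancel₀ hV.ne'; linarith [h.pp]
    rw [div_eq_iff hW.ne'] at h1
    linarith
  · intro h
    apply Quarters.of_halves (volume_half_chord b i hx) (volume_half_chord b (i + 1) _)
    · have h1 : (x + y - 1) ^ 2 / (2 * x ^ 2 + 2 * y ^ 2 - 1) = 1 / 4 := by
        rw [div_eq_iff hW.ne']; linarith
      rw [hvol, h1]; ring
    · have := hy.1
      constructor
      · rw [div_lt_div_iff₀ (by norm_num) (by positivity)]; linarith [hy.2]
      · rw [div_le_one (by positivity)]; linarith

lemma area_equation_iff {x y : ℝ} (hx : x ∈ Ioc (1 / 2) 1) (hy : y ∈ Ico (1 / 2) 1) :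
    4 * (x + y - 1) ^ 2 = 2 * x ^ 2 + 2 * y ^ 2 - 1 ↔ √2 / 2 < x ∧ y = yOf x := by
  constructor
  · intro h
    have hy' : y = yOf x := by
      apply eq_yOf
      · linear_combination h / 2
      · by_contra hc
        push Not at hc
        nlinarith [hx.1, hy.1, mul_nonneg (by linarith [hx.1] : 0 ≤ x - 1 / 2)
          (by linarith [hy.1] : 0 ≤ y - 1 / 2)]
    refine ⟨?_, hy'⟩
    rw [← yOf_yOf x, ← hy', ← yOf_one]
    exact yOf_strictAnti hy.2
  · rintro ⟨-, rfl⟩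
    linear_combination 2 * yOf_area x

lemma yOf_mem_Ico {x : ℝ} (hx : x ∈ Ioc (√2 / 2) 1) : yOf x ∈ Ico (√2 / 2) 1 := by
  refine ⟨(yOf_mem ⟨hx.1.le, hx.2⟩).1, ?_⟩
  rw [← yOf_sqrt_two_half]
  exact yOf_strictAnti hx.1

/-! ### Classification of the bisecting lines. -/

/-- One vertex is separated from the other two. The weak sign at `i + 1` and the strict one at `i +
2` assign a line through a vertex to one corner only. -/
lemma exists_sign_pattern (a : Fin 3 → ℝ) {j k : Fin 3} (hj : 0 < a j) (hk : a k < 0) :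
    ∃ i, a i ≠ 0 ∧ a (i + 1) / a i ≤ 0 ∧ a (i + 2) / a i < 0 := by
  have key : ∃ i, (0 < a i ∧ a (i + 1) ≤ 0 ∧ a (i + 2) < 0) ∨
      (a i < 0 ∧ 0 ≤ a (i + 1) ∧ 0 < a (i + 2)) := by
    have e0 : (∃ i, (0 < a i ∧ a (i + 1) ≤ 0 ∧ a (i + 2) < 0) ∨
      (a i < 0 ∧ 0 ≤ a (i + 1) ∧ 0 < a (i + 2))) ↔
      ((0 < a 0 ∧ a 1 ≤ 0 ∧ a 2 < 0) ∨ (a 0 < 0 ∧ 0 ≤ a 1 ∧ 0 < a 2)) ∨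
      ((0 < a 1 ∧ a 2 ≤ 0 ∧ a 0 < 0) ∨ (a 1 < 0 ∧ 0 ≤ a 2 ∧ 0 < a 0)) ∨
      ((0 < a 2 ∧ a 0 ≤ 0 ∧ a 1 < 0) ∨ (a 2 < 0 ∧ 0 ≤ a 0 ∧ 0 < a 1)) := by
      rw [Fin.exists_fin_succ, Fin.exists_fin_two]; rfl
    rw [e0]
    have hp : 0 < a 0 ∨ 0 < a 1 ∨ 0 < a 2 := by fin_cases j <;> simp_all
    have hn : a 0 < 0 ∨ a 1 < 0 ∨ a 2 < 0 := by fin_cases k <;> simp_all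
    grind
  obtain ⟨i, ⟨h1, h2, h3⟩ | ⟨h1, h2, h3⟩⟩ := key
  · exact ⟨i, h1.ne', div_nonpos_of_nonpos_of_nonneg h2 h1.le, div_neg_of_neg_of_pos h3 h1⟩
  · exact ⟨i, h1.ne, div_nonpos_of_nonneg_of_nonpos h2 h1.le, div_neg_of_pos_of_neg h3 h1⟩

lemma exists_chordFn (b : AffineBasis (Fin 3) ℝ Plane) (f : Plane →ᵃ[ℝ] ℝ)
    (hf : volume.real (half (hull b) f) = volume.real (hull b) / 2)
    (hf' : volume.real (half (hull b) (-f)) = volume.real (hull b) / 2) :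
    ∃ i, ∃ s ∈ Ioc (1 / 2 : ℝ) 1, ∃ c : ℝ, c ≠ 0 ∧ f = c • chordFn b i s := by
  have hV := volume_hull_pos b
  have ex : ∀ f : Plane →ᵃ[ℝ] ℝ, volume.real (half (hull b) f) = volume.real (hull b) / 2 →
      ∃ j, 0 < f (b j) := by
    intro f hf
    by_contra hc
    push Not at hc
    have : half (hull b) f = ∅ := by
      rw [eq_empty_iff_forall_notMem]
      rintro z ⟨h1, h2⟩
      rw [mem_hull b 0] at h1
      rw [affine_apply_eq b f 0] at h2
      have m0 := mul_nonpos_of_nonneg_of_nonpos h1.1 (hc 0)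
      have m1 := mul_nonpos_of_nonneg_of_nonpos h1.2.1 (hc (0 + 1))
      have m2 := mul_nonpos_of_nonneg_of_nonpos h1.2.2 (hc (0 + 2))
      linarith
    rw [this, measureReal_empty] at hf
    linarith
  obtain ⟨j, hj⟩ := ex f hf
  obtain ⟨k, hk⟩ := ex (-f) hf'
  obtain ⟨i, h0, h1, h2⟩ := exists_sign_pattern (fun i => f (b i)) hj
    (neg_pos.1 (by simpa using hk))
  set α := f (b (i + 1)) / f (b i) with hα
  set β := f (b (i + 2)) / f (b i) with hβ
  have hs : 1 / (1 - α) ∈ Ioc (0 : ℝ) 1 :=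
    ⟨one_div_pos.2 (by linarith), (div_le_one (by linarith)).2 (by linarith)⟩
  have hp : 1 / (1 - β) ∈ Ioc (0 : ℝ) 1 :=
    ⟨one_div_pos.2 (by linarith), (div_le_one (by linarith)).2 (by linarith)⟩
  have hfc : f = f (b i) • cornerFn b i (1 / (1 - α)) (1 / (1 - β)) := by
    ext z
    rw [affine_apply_eq b f i]
    simp only [AffineMap.coe_smul, Pi.smul_apply, smul_eq_mul, cornerFn_apply, one_div_one_div]
    rw [hα, hβ]; field_simp; ring
  have hhalf : volume.real (half (hull b) (cornerFn b i (1 / (1 - α)) (1 / (1 - β)))) =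
      volume.real (hull b) / 2 := by
    rcases lt_or_gt_of_ne h0 with hneg | hpos
    · rw [hfc, ← neg_smul, half_smul (neg_pos.2 hneg)] at hf'
      exact hf'
    · rw [hfc, half_smul hpos] at hf
      exact hf
  rw [volume_half_corner b i hs hp] at hhalf
  have hsp : 1 / (1 - α) * (1 / (1 - β)) = 1 / 2 := by
    apply mul_right_cancel₀ hV.ne'; linarith
  have hp' : 1 / (1 - β) = 1 / (2 * (1 / (1 - α))) := by
    have := hs.1.ne'
    rw [eq_div_iff (by positivity)]; linear_combination 2 * hsp
  refine ⟨i, 1 / (1 - α), ⟨?_, hs.2⟩, f (b i), h0, ?_⟩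
  -- The strict sign at `i + 2` is what makes `s > 1/2`.
  · have hp1 : 1 / (1 - β) < 1 := (div_lt_one (by linarith)).2 (by linarith)
    have := mul_lt_mul_of_pos_left hp1 hs.1
    linarith
  · rw [chordFn, ← hp']; exact hfc

/-! ### Chords -/

/-- The end on the edge from `b i` to `b (i + 1)` of a bisecting chord. -/
def near (b : AffineBasis (Fin 3) ℝ Plane) (i : Fin 3) (s : ℝ) : Plane :=
  AffineMap.lineMap (b i) (b (i + 1)) s

/-- The end on the edge from `b i` to `b (i + 2)` of a bisecting chord. -/
def far (b : AffineBasis (Fin 3) ℝ Plane) (i : Fin 3) (s : ℝ) : Plane :=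
  AffineMap.lineMap (b i) (b (i + 2)) (1 / (2 * s))

/-- A chord which bisects the triangle. -/
def chord (b : AffineBasis (Fin 3) ℝ Plane) (i : Fin 3) (s : ℝ) : Set Plane :=
  segment ℝ (near b i s) (far b i s)

lemma coord_near (b : AffineBasis (Fin 3) ℝ Plane) (i : Fin 3) (s : ℝ) :
    b.coord i (near b i s) = 1 - s ∧ b.coord (i + 1) (near b i s) = s ∧
    b.coord (i + 2) (near b i s) = 0 := by
  simp only [near, AffineMap.apply_lineMap]
  refine ⟨?_, ?_, ?_⟩ <;> simp [AffineMap.lineMap_apply, b.coord_apply]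
  ring

lemma coord_far (b : AffineBasis (Fin 3) ℝ Plane) (i : Fin 3) (s : ℝ) :
    b.coord i (far b i s) = 1 - 1 / (2 * s) ∧ b.coord (i + 1) (far b i s) = 0 ∧
    b.coord (i + 2) (far b i s) = 1 / (2 * s) := by
  simp only [far, AffineMap.apply_lineMap]
  refine ⟨?_, ?_, ?_⟩ <;> simp [AffineMap.lineMap_apply, b.coord_apply]
  ring

lemma ext_coord (b : AffineBasis (Fin 3) ℝ Plane) (i : Fin 3) {z w : Plane}
    (h1 : b.coord (i + 1) z = b.coord (i + 1) w) (h2 : b.coord (i + 2) z = b.coord (i + 2) w) :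
    z = w := by
  apply b.ext_elem
  rw [forall_fin_three i]
  exact ⟨by linarith [coord_sum b i z, coord_sum b i w], h1, h2⟩

lemma mem_frontier_hull (b : AffineBasis (Fin 3) ℝ Plane) (i : Fin 3) {z : Plane} :
    z ∈ frontier (hull b) ↔ z ∈ hull b ∧
      (b.coord i z = 0 ∨ b.coord (i + 1) z = 0 ∨ b.coord (i + 2) z = 0) := by
  rw [frontier, (isCompact_hull b).isClosed.closure_eq, mem_sdiff]
  refine and_congr_right fun hz => ?_
  rw [hull, b.interior_convexHull, mem_ofPred_eq, forall_fin_three i]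
  rw [mem_hull b i] at hz
  obtain ⟨h0, h1, h2⟩ := hz
  rw [h0.lt_iff_ne', h1.lt_iff_ne', h2.lt_iff_ne']
  tauto

lemma near_mem_frontier (b : AffineBasis (Fin 3) ℝ Plane) (i : Fin 3) {s : ℝ}
    (hs : s ∈ Ioc (1 / 2) 1) : near b i s ∈ frontier (hull b) := by
  obtain ⟨h0, h1, h2⟩ := coord_near b i s
  rw [mem_frontier_hull b i, mem_hull b i, h0, h1, h2]
  exact ⟨⟨by linarith [hs.2], by linarith [hs.1], le_rfl⟩, Or.inr (Or.inr rfl)⟩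

lemma far_mem_frontier (b : AffineBasis (Fin 3) ℝ Plane) (i : Fin 3) {s : ℝ}
    (hs : s ∈ Ioc (1 / 2) 1) : far b i s ∈ frontier (hull b) := by
  obtain ⟨h0, h1, h2⟩ := coord_far b i s
  have hp : 0 < s := by linarith [hs.1]
  have : 1 / (2 * s) ≤ 1 := by rw [div_le_one (by positivity)]; linarith [hs.1]
  rw [mem_frontier_hull b i, mem_hull b i, h0, h1, h2]
  exact ⟨⟨by linarith, le_rfl, by positivity⟩, Or.inr (Or.inl rfl)⟩

lemma near_ne_far (b : AffineBasis (Fin 3) ℝ Plane) (i : Fin 3) {s : ℝ}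
    (hs : s ∈ Ioc (1 / 2) 1) : near b i s ≠ far b i s := by
  intro h
  have h1 := (coord_near b i s).2.1
  rw [h, (coord_far b i s).2.1] at h1
  linarith [hs.1]

lemma coord_of_chordFn_eq_zero (b : AffineBasis (Fin 3) ℝ Plane) (i : Fin 3) {s : ℝ}
    (hs : s ∈ Ioc (1 / 2) 1) {z : Plane} (hz : chordFn b i s z = 0) :
    b.coord (i + 1) z = s - 2 * s ^ 2 * b.coord (i + 2) z ∧
    b.coord i z = 1 - s + (2 * s ^ 2 - 1) * b.coord (i + 2) z := by
  have h0 : 0 < s := by linarith [hs.1]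
  rw [chordFn_apply] at hz
  field_simp at hz
  have := coord_sum b i z
  constructor <;> nlinarith

lemma chord_eq (b : AffineBasis (Fin 3) ℝ Plane) (i : Fin 3) {s : ℝ} (hs : s ∈ Ioc (1 / 2) 1) :
    chord b i s = {z ∈ hull b | chordFn b i s z = 0} := by
  have h0 : 0 < s := by linarith [hs.1]
  apply Subset.antisymm
  · have hc : Convex ℝ {z ∈ hull b | chordFn b i s z = 0} :=
      (convex_hull b).inter ((convex_singleton (0 : ℝ)).affine_preimage (chordFn b i s))
    apply hc.segment_subset
    · refine ⟨(mem_frontier_hull b i).1 (near_mem_frontier b i hs) |>.1, ?_⟩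
      obtain ⟨h1, h2, h3⟩ := coord_near b i s
      rw [chordFn_apply, h1, h2, h3]; field_simp; ring
    · refine ⟨(mem_frontier_hull b i).1 (far_mem_frontier b i hs) |>.1, ?_⟩
      obtain ⟨h1, h2, h3⟩ := coord_far b i s
      rw [chordFn_apply, h1, h2, h3]; field_simp; ring
  · rintro z ⟨hz, hz0⟩
    obtain ⟨hu, hw⟩ := coord_of_chordFn_eq_zero b i hs hz0
    rw [mem_hull b i] at hz
    rw [chord, segment_eq_image_lineMap]
    refine ⟨2 * s * b.coord (i + 2) z, ⟨by have := hz.2.2; positivity, ?_⟩, ?_⟩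
    · have h1 := hz.2.1
      rw [hu] at h1
      have : s * (2 * s * b.coord (i + 2) z) ≤ s * 1 := by linarith
      exact le_of_mul_le_mul_left this h0
    · obtain ⟨-, n2, n3⟩ := coord_near b i s
      obtain ⟨-, f2, f3⟩ := coord_far b i s
      apply ext_coord b i
      · rw [AffineMap.apply_lineMap, n2, f2, AffineMap.lineMap_apply_ring', hu]; ring
      · rw [AffineMap.apply_lineMap, n3, f3, AffineMap.lineMap_apply_ring']; field_simp; ring

lemma eq_near_or_far (b : AffineBasis (Fin 3) ℝ Plane) (i : Fin 3) {s : ℝ}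
    (hs : s ∈ Ioc (1 / 2) 1) {z : Plane} (hz : chordFn b i s z = 0)
    (hf : z ∈ frontier (hull b)) : z = near b i s ∨ z = far b i s := by
  obtain ⟨hs0, hs1⟩ := hs
  have h0 : 0 < s := by linarith
  obtain ⟨hu, hw⟩ := coord_of_chordFn_eq_zero b i ⟨hs0, hs1⟩ hz
  rw [mem_frontier_hull b i, mem_hull b i] at hf
  obtain ⟨⟨c0, c1, c2⟩, hf⟩ := hf
  obtain ⟨-, n2, n3⟩ := coord_near b i s
  obtain ⟨-, f2, f3⟩ := coord_far b i s
  have near_of : b.coord (i + 2) z = 0 → z = near b i s := by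
    intro h
    apply ext_coord b i
    · rw [hu, h, n2]; ring
    · rw [h, n3]
  rcases hf with h | h | h
  · left
    apply near_of
    rw [h] at hw
    rw [hu] at c1
    have e : 2 * s * (1 - s) + (2 * s ^ 2 - 1) * (2 * s * b.coord (i + 2) z) = 0 := by
      linear_combination (-2 * s) * hw
    have e1 : 2 * s * b.coord (i + 2) z ≤ 1 := by
      have : s * (2 * s * b.coord (i + 2) z) ≤ s * 1 := by linarith
      exact le_of_mul_le_mul_left this h0
    -- With `τ = 2s · coord (i+2)` the position along the chord, this is, up to the factor `2s`, the
    -- interpolation of `coord i` between its end values. Both terms are nonnegative and `s > 1/2`,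
    -- so `τ = 0`.
    have e2 : 2 * s * (1 - s) * (1 - 2 * s * b.coord (i + 2) z) +
        (2 * s - 1) * (2 * s * b.coord (i + 2) z) = 0 := by linear_combination e
    have e3 : 0 ≤ 2 * s * (1 - s) * (1 - 2 * s * b.coord (i + 2) z) :=
      mul_nonneg (mul_nonneg (by linarith) (by linarith)) (by linarith)
    have e4 : 0 ≤ (2 * s - 1) * (2 * s * b.coord (i + 2) z) :=
      mul_nonneg (by linarith) (by positivity)
    have e5 : (2 * s - 1) * (2 * s * b.coord (i + 2) z) = 0 := by linarith
    rcases mul_eq_zero.1 e5 with h5 | h5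
    · linarith
    · rcases mul_eq_zero.1 h5 with h6 | h6
      · linarith
      · exact h6
  · right
    rw [h] at hu
    apply ext_coord b i
    · rw [h, f2]
    · rw [f3, eq_div_iff (by positivity)]
      apply mul_left_cancel₀ h0.ne'
      linarith
  · exact Or.inl (near_of h)

lemma endpoints_of_frontier (b : AffineBasis (Fin 3) ℝ Plane) (i : Fin 3) {s : ℝ}
    (hs : s ∈ Ioc (1 / 2) 1) {X P : Plane} (hX : chordFn b i s X = 0)
    (hP : chordFn b i s P = 0) (hX' : X ∈ frontier (hull b)) (hP' : P ∈ frontier (hull b))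
    (hne : P ≠ X) : segment ℝ X P = chord b i s ∧
      ∃ c : ℝ, c ≠ 0 ∧ P - X = c • (far b i s - near b i s) := by
  rcases eq_near_or_far b i hs hX hX' with rfl | rfl <;>
    rcases eq_near_or_far b i hs hP hP' with rfl | rfl
  · exact absurd rfl hne
  · exact ⟨rfl, 1, one_ne_zero, by simp⟩
  · exact ⟨segment_symm _ _ _, -1, by simp, by simp⟩
  · exact absurd rfl hne

/-- For different corners, the far end of one chord lies strictly off the line of the other; this
uses `s > 1/2`, which excludes the second description of a median. -/
lemma chord_injective (b : AffineBasis (Fin 3) ℝ Plane) {i j : Fin 3} {s s' : ℝ}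
    (hs : s ∈ Ioc (1 / 2) 1) (hs' : s' ∈ Ioc (1 / 2) 1) (h : chord b i s = chord b j s') :
    i = j ∧ s = s' := by
  have h0 : 0 < s := by linarith [hs.1]
  have h0' : 0 < s' := by linarith [hs'.1]
  have next : ∀ {i : Fin 3} {s s' : ℝ}, s ∈ Ioc (1 / 2) 1 → s' ∈ Ioc (1 / 2) 1 →
      chord b i s ≠ chord b (i + 1) s' := by
    intro i s s' hs hs' h
    have h0 : 0 < s := by linarith [hs.1]
    have h0' : 0 < s' := by linarith [hs'.1]
    have hP : far b i s ∈ chord b (i + 1) s' := h ▸ right_mem_segment ℝ _ _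
    rw [chord_eq b (i + 1) hs'] at hP
    have hP := hP.2
    have e : s' = 1 / (2 * (1 / (2 * s'))) := by field_simp
    obtain ⟨f1, f2, f3⟩ := coord_far b i s
    rw [e, chordFn_succ_apply, f1, f2, f3] at hP
    have e1 : 1 / (1 / (2 * s')) = 2 * s' := one_div_one_div _
    have e2 : 2 * (1 / (2 * s')) = 1 / s' := by field_simp
    rw [e1, e2] at hP
    have p1 : 1 / (2 * s) < 1 := by rw [div_lt_one (by positivity)]; linarith [hs.1]
    have p2 : 1 ≤ 1 / s' := by rw [le_div_iff₀ h0']; linarith [hs'.2]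
    have p3 : 0 ≤ (1 / s' - 1) * (1 / (2 * s)) := mul_nonneg (by linarith) (by positivity)
    have p4 : 0 < (2 * s' - 1) * (1 - 1 / (2 * s)) :=
      mul_pos (by linarith [hs'.1]) (by linarith)
    linarith
  have hij : i = j ∨ j = i + 1 ∨ i = j + 1 := by
    clear h
    revert i j; decide
  rcases hij with rfl | rfl | rfl
  · refine ⟨rfl, ?_⟩
    have hX : near b i s ∈ chord b i s' := h ▸ left_mem_segment ℝ _ _
    rw [chord_eq b i hs'] at hX
    have hX := hX.2
    obtain ⟨h1, h2, h3⟩ := coord_near b i s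
    rw [chordFn_apply, h1, h2, h3] at hX
    field_simp at hX
    nlinarith
  · exact absurd h (next hs hs')
  · exact absurd h.symm (next hs' hs)

/-! ### Regions -/

lemma convex_cut {K : Set Plane} (hK : Convex ℝ K) (f g : Plane →ᵃ[ℝ] ℝ) :
    Convex ℝ (cut K f g) :=
  hK.inter (((convex_Ioi (0 : ℝ)).affine_preimage f).inter
    ((convex_Ioi (0 : ℝ)).affine_preimage g))

/-- Each open quadrant of the triangle is convex and misses both segments, so it lies in one
component and has at most a quarter of the area. The four areas add up to the whole, forcing
equality. -/
lemma Quarters.of_components (b : AffineBasis (Fin 3) ℝ Plane) {f g : Plane →ᵃ[ℝ] ℝ}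
    {s t : Set Plane} {u w : Plane} (hu : f u ≠ 0) (hw : g w ≠ 0) (hs : ∀ z ∈ s, f z = 0)
    (ht : ∀ z ∈ t, g z = 0)
    (h : ∀ z ∈ hull b \ (s ∪ t), volume (connectedComponentIn (hull b \ (s ∪ t)) z) =
      volume (hull b) / 4) : Quarters b f g := by
  have le : ∀ {f g : Plane →ᵃ[ℝ] ℝ}, (∀ z ∈ s, f z = 0) → (∀ z ∈ t, g z = 0) →
      volume.real (cut (hull b) f g) ≤ volume.real (hull b) / 4 := by
    intro f g hs ht
    have hsub : cut (hull b) f g ⊆ hull b \ (s ∪ t) := by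
      rintro z ⟨h1, h2, h3⟩
      refine ⟨h1, ?_⟩
      rintro (h4 | h4)
      · exact h2.ne' (hs z h4)
      · exact h3.ne' (ht z h4)
    rcases (cut (hull b) f g).eq_empty_or_nonempty with he | ⟨z, hz⟩
    · rw [he, measureReal_empty]
      linarith [volume_hull_pos b]
    · have h1 := (convex_cut (convex_hull b) f g).isPreconnected.subset_connectedComponentIn hz hsub
      have h2 := h z (hsub hz)
      have h3 : volume.real (connectedComponentIn (hull b \ (s ∪ t)) z) =
          volume.real (hull b) / 4 := by
        rw [measureReal_def, h2, ENNReal.toReal_div]; rfl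
      rw [← h3]
      exact measureReal_mono h1 (volume_ne_top_of_subset_hull b
        ((connectedComponentIn_subset _ _).trans sdiff_subset))
  have hs' : ∀ z ∈ s, (-f) z = 0 := fun z hz => neg_eq_zero.2 (hs z hz)
  have ht' : ∀ z ∈ t, (-g) z = 0 := fun z hz => neg_eq_zero.2 (ht z hz)
  have l1 := le hs ht
  have l2 := le hs ht'
  have l3 := le hs' ht
  have l4 := le hs' ht'
  have e1 := hull_eq_add b f hu
  have e2 := half_eq_add b f g hw
  have e3 := half_eq_add b (-f) g hw
  constructor <;> linarith

/-- A quadrant is convex, and by the intermediate value theorem neither function changes sign on a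
component. -/
lemma connectedComponentIn_eq_cut {K : Set Plane} (hK : Convex ℝ K) {f g : Plane →ᵃ[ℝ] ℝ}
    {z : Plane} (hz : z ∈ cut K f g) :
    connectedComponentIn {z ∈ K | f z ≠ 0 ∧ g z ≠ 0} z = cut K f g := by
  have hsub : cut K f g ⊆ {z ∈ K | f z ≠ 0 ∧ g z ≠ 0} :=
    fun w hw => ⟨hw.1, hw.2.1.ne', hw.2.2.ne'⟩
  apply Subset.antisymm
  · have hz' := mem_connectedComponentIn (hsub hz)
    have pos : ∀ f' : Plane →ᵃ[ℝ] ℝ, 0 < f' z →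
        (∀ w ∈ {z ∈ K | f z ≠ 0 ∧ g z ≠ 0}, f' w ≠ 0) →
        ∀ w ∈ connectedComponentIn {z ∈ K | f z ≠ 0 ∧ g z ≠ 0} z, 0 < f' w := by
      intro f' hf hne w hw
      by_contra hc
      obtain ⟨p, hp, hp0⟩ := isPreconnected_connectedComponentIn.intermediate_value hw hz'
        f'.continuous_of_finiteDimensional.continuousOn ⟨not_lt.1 hc, hf.le⟩
      exact hne p (connectedComponentIn_subset _ _ hp) hp0
    intro w hw
    exact ⟨(connectedComponentIn_subset _ _ hw).1, pos f hz.2.1 (fun w hw => hw.2.1) w hw,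
      pos g hz.2.2 (fun w hw => hw.2.2) w hw⟩
  · exact (convex_cut hK f g).isPreconnected.subset_connectedComponentIn hz hsub

lemma Quarters.components {b : AffineBasis (Fin 3) ℝ Plane} {f g : Plane →ᵃ[ℝ] ℝ}
    (h : Quarters b f g) :
    {C | ∃ z ∈ {z ∈ hull b | f z ≠ 0 ∧ g z ≠ 0},
      C = connectedComponentIn {z ∈ hull b | f z ≠ 0 ∧ g z ≠ 0} z} =
    {cut (hull b) f g, cut (hull b) f (-g), cut (hull b) (-f) g, cut (hull b) (-f) (-g)} := by
  have key : ∀ {f' g' : Plane →ᵃ[ℝ] ℝ} {z : Plane}, (f' = f ∨ f' = -f) → (g' = g ∨ g' = -g) →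
      z ∈ cut (hull b) f' g' →
      connectedComponentIn {z ∈ hull b | f z ≠ 0 ∧ g z ≠ 0} z = cut (hull b) f' g' := by
    intro f' g' z hf hg hz
    rw [← connectedComponentIn_eq_cut (convex_hull b) hz]
    congr 1
    ext w
    rcases hf with rfl | rfl <;> rcases hg with rfl | rfl <;> simp
  ext C
  constructor
  · rintro ⟨z, ⟨h1, h2, h3⟩, rfl⟩
    rcases lt_or_gt_of_ne h2 with h2 | h2 <;> rcases lt_or_gt_of_ne h3 with h3 | h3
    · rw [key (f' := -f) (g' := -g) (Or.inr rfl) (Or.inr rfl) ⟨h1, neg_pos.2 h2, neg_pos.2 h3⟩]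
      simp
    · rw [key (f' := -f) (g' := g) (Or.inr rfl) (Or.inl rfl) ⟨h1, neg_pos.2 h2, h3⟩]
      simp
    · rw [key (f' := f) (g' := -g) (Or.inl rfl) (Or.inr rfl) ⟨h1, h2, neg_pos.2 h3⟩]
      simp
    · rw [key (f' := f) (g' := g) (Or.inl rfl) (Or.inl rfl) ⟨h1, h2, h3⟩]
      simp
  · have mk : ∀ {f' g' : Plane →ᵃ[ℝ] ℝ}, (f' = f ∨ f' = -f) → (g' = g ∨ g' = -g) →
        Quarters b f' g' → ∃ z ∈ {z ∈ hull b | f z ≠ 0 ∧ g z ≠ 0}, cut (hull b) f' g' =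
          connectedComponentIn {z ∈ hull b | f z ≠ 0 ∧ g z ≠ 0} z := by
      intro f' g' hf hg hq
      obtain ⟨z, h1, h2, h3⟩ := hq.exists_ne
      refine ⟨z, ⟨h1, ?_, ?_⟩, (key hf hg ⟨h1, h2, h3⟩).symm⟩
      · rcases hf with rfl | rfl
        · exact h2.ne'
        · exact (neg_pos.1 h2).ne
      · rcases hg with rfl | rfl
        · exact h3.ne'
        · exact (neg_pos.1 h3).ne
    rintro (rfl | rfl | rfl | rfl)
    · exact mk (Or.inl rfl) (Or.inl rfl) h
    · exact mk (Or.inl rfl) (Or.inr rfl) h.symm.neg.symm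
    · exact mk (Or.inr rfl) (Or.inl rfl) h.neg
    · exact mk (Or.inr rfl) (Or.inr rfl) h.neg.symm.neg.symm

lemma Quarters.encard_components {b : AffineBasis (Fin 3) ℝ Plane} {f g : Plane →ᵃ[ℝ] ℝ}
    (h : Quarters b f g) : ({cut (hull b) f g, cut (hull b) f (-g), cut (hull b) (-f) g,
      cut (hull b) (-f) (-g)} : Set (Set Plane)).encard = 4 := by
  have ne : ∀ {f' g' f'' g'' : Plane →ᵃ[ℝ] ℝ}, Quarters b f' g' → (f'' = -f' ∨ g'' = -g') →
      cut (hull b) f' g' ≠ cut (hull b) f'' g'' := by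
    intro f' g' f'' g'' hq hor he
    obtain ⟨z, h1, h2, h3⟩ := hq.exists_ne
    have hz : z ∈ cut (hull b) f'' g'' := he ▸ ⟨h1, h2, h3⟩
    rcases hor with rfl | rfl
    · exact absurd (neg_pos.1 hz.2.1) (not_lt.2 h2.le)
    · exact absurd (neg_pos.1 hz.2.2) (not_lt.2 h3.le)
  have hpn := h.symm.neg.symm
  have hnp := h.neg
  rw [encard_insert_of_notMem, encard_insert_of_notMem, encard_pair]
  · norm_num
  · exact ne hnp (Or.inr rfl)
  · rintro (h1 | h1)
    · exact ne hpn (Or.inl rfl) h1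
    · exact ne hpn (Or.inl rfl) h1
  · rintro (h1 | h1 | h1)
    · exact ne h (Or.inr rfl) h1
    · exact ne h (Or.inl rfl) h1
    · exact ne h (Or.inl rfl) h1

lemma Quarters.volume_components {b : AffineBasis (Fin 3) ℝ Plane} {f g : Plane →ᵃ[ℝ] ℝ}
    (h : Quarters b f g) : ∀ C ∈ ({cut (hull b) f g, cut (hull b) f (-g), cut (hull b) (-f) g,
      cut (hull b) (-f) (-g)} : Set (Set Plane)), volume C = volume (hull b) / 4 := by
  have key : ∀ {f' g' : Plane →ᵃ[ℝ] ℝ}, volume.real (cut (hull b) f' g') =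
      volume.real (hull b) / 4 → volume (cut (hull b) f' g') = volume (hull b) / 4 := by
    intro f' g' he
    rw [← ENNReal.toReal_eq_toReal_iff' (volume_ne_top_of_subset_hull b fun z hz => hz.1)
      (ENNReal.div_ne_top (volume_hull_ne_top b) (by norm_num)), ENNReal.toReal_div]
    exact he
  rintro C (rfl | rfl | rfl | rfl)
  exacts [key h.pp, key h.pn, key h.np, key h.nn]

lemma exists_line_fn {X P : Plane} (h : P ≠ X) :
    ∃ f : Plane →ᵃ[ℝ] ℝ, f X = 0 ∧ f P = 0 ∧ ∃ w, f w ≠ 0 := by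
  let v := P - X
  let l : Plane →ₗ[ℝ] ℝ := v 0 • (EuclideanSpace.proj (𝕜 := ℝ) (1 : Fin 2)).toLinearMap -
    v 1 • (EuclideanSpace.proj (𝕜 := ℝ) (0 : Fin 2)).toLinearMap
  have hl : ∀ z, l z = v 0 * z 1 - v 1 * z 0 := fun z => by simp [l]
  let f : Plane →ᵃ[ℝ] ℝ := l.toAffineMap - AffineMap.const ℝ Plane (l X)
  have hf : ∀ z, f z = l (z - X) := fun z => by simp [f]
  refine ⟨f, by simp [hf], ?_, X + !₂[-v 1, v 0], ?_⟩
  · rw [hf, hl]; change v 0 * v 1 - v 1 * v 0 = 0; ring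
  · have hv : v ≠ 0 := sub_ne_zero.2 h
    rw [hf, hl]
    simp only [add_sub_cancel_left]
    intro h0
    simp at h0
    apply hv
    ext j
    fin_cases j <;> simp <;> nlinarith

/-! ### Quadrisections and zeros -/

/-- The projection of the vertex opposite to the edge `i` on this edge, as a fraction of it. -/
def foot (b : AffineBasis (Fin 3) ℝ Plane) (i : Fin 3) : ℝ :=
  inner ℝ (b (i + 2) - b i) (b (i + 1) - b i) / ‖b (i + 1) - b i‖ ^ 2

/-- The squared length of the third edge, in terms of that of the edge `i`. -/
def ratio (b : AffineBasis (Fin 3) ℝ Plane) (i : Fin 3) : ℝ :=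
  ‖b (i + 2) - b i‖ ^ 2 / ‖b (i + 1) - b i‖ ^ 2

lemma edge_ne_zero (b : AffineBasis (Fin 3) ℝ Plane) (i : Fin 3) : b (i + 1) - b i ≠ 0 :=
  sub_ne_zero.2 fun h => (add_one_ne i).1 (b.ind.injective h)

/-- Expanding in the edge vectors turns perpendicularity into the circle equation; the last factor
becomes `power` once `y = yOf x`. -/
lemma inner_chords (b : AffineBasis (Fin 3) ℝ Plane) (i : Fin 3) {x y : ℝ} (hx : x ≠ 0)
    (hy : y ≠ 0) : inner ℝ (far b i x - near b i x)
      (far b (i + 1) (1 / (2 * y)) - near b (i + 1) (1 / (2 * y))) =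
    -(‖b (i + 1) - b i‖ ^ 2 / (4 * x * y)) * (ratio b i - 2 * foot b i * (x ^ 2 - y ^ 2 + 1 / 2) +
      2 * x ^ 2 * (1 - 2 * y ^ 2)) := by
  have h1 : i + 1 + 1 = i + 2 := by fin_cases i <;> rfl
  have h2 : i + 1 + 2 = i := by fin_cases i <;> rfl
  set e := b (i + 1) - b i with he
  set w := b (i + 2) - b i with hw
  have e1 : far b i x - near b i x = (1 / (2 * x)) • w - x • e := by
    simp only [far, near, AffineMap.lineMap_apply_module', ← he, ← hw]; abel
  have e2 : far b (i + 1) (1 / (2 * y)) - near b (i + 1) (1 / (2 * y)) =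
      (1 / (2 * y) - y) • e - (1 / (2 * y)) • w := by
    simp only [far, near, h1, h2, AffineMap.lineMap_apply_module']
    have e3 : b i - b (i + 1) = -e := by rw [he]; abel
    have e4 : b (i + 2) - b (i + 1) = w - e := by rw [he, hw]; abel
    have e5 : 1 / (2 * (1 / (2 * y))) = y := by field_simp
    rw [e3, e4, e5]
    module
  have hn : ‖e‖ ≠ 0 := norm_ne_zero_iff.2 (edge_ne_zero b i)
  have hf : foot b i * ‖e‖ ^ 2 = inner ℝ w e := by unfold foot; rw [← he, ← hw]; field_simp
  have hr : ratio b i * ‖e‖ ^ 2 = ‖w‖ ^ 2 := by unfold ratio; rw [← he, ← hw]; field_simp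
  rw [e1, e2]
  simp only [inner_sub_left, inner_sub_right, real_inner_smul_left, real_inner_smul_right,
    real_inner_self_eq_norm_sq, real_inner_comm w e]
  rw [← hf, ← hr]
  field_simp
  ring

lemma inner_chords_eq_zero_iff (b : AffineBasis (Fin 3) ℝ Plane) (i : Fin 3) {x : ℝ}
    (hx : x ∈ Ioc (√2 / 2) 1) : inner ℝ (far b i x - near b i x)
      (far b (i + 1) (1 / (2 * yOf x)) - near b (i + 1) (1 / (2 * yOf x))) = 0 ↔
    power (foot b i) (ratio b i) x = 0 := by
  have hx0 : 0 < x := by linarith [hx.1, sqrt_two_half_gt]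
  have hy0 : 0 < yOf x := by linarith [(yOf_mem_Ico hx).1, sqrt_two_half_gt]
  have hn : ‖b (i + 1) - b i‖ ≠ 0 := norm_ne_zero_iff.2 (edge_ne_zero b i)
  rw [inner_chords b i hx0.ne' hy0.ne', mul_eq_zero, or_iff_right]
  · rfl
  · exact neg_ne_zero.2 (by positivity)

/-- The vertices of a triangle as an affine basis. -/
def triBasis (T : Affine.Triangle ℝ Plane) : AffineBasis (Fin 3) ℝ Plane :=
  ⟨T.points, T.independent, by
    rw [T.independent.affineSpan_eq_top_iff_card_eq_finrank_add_one]; simp⟩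

lemma hull_triBasis (T : Affine.Triangle ℝ Plane) : hull (triBasis T) = body T := rfl

lemma inv_two_mul_mem {y : ℝ} (hy : y ∈ Ico (1 / 2) 1) : 1 / (2 * y) ∈ Ioc (1 / 2 : ℝ) 1 := by
  have := hy.1
  constructor
  · rw [div_lt_div_iff₀ (by norm_num) (by positivity)]; linarith [hy.2]
  · rw [div_le_one (by positivity)]; linarith

lemma mem_Ioc_half {x : ℝ} (hx : x ∈ Ioc (√2 / 2) 1) : x ∈ Ioc (1 / 2) 1 :=
  ⟨by linarith [hx.1, sqrt_two_half_gt], hx.2⟩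

lemma yOf_mem_Ico_half {x : ℝ} (hx : x ∈ Ioc (√2 / 2) 1) : yOf x ∈ Ico (1 / 2) 1 :=
  ⟨by linarith [(yOf_mem_Ico hx).1, sqrt_two_half_gt], (yOf_mem_Ico hx).2⟩

/-- The pair of chords of parameter `x` with two ends on the edge `i`. -/
def chordPair (b : AffineBasis (Fin 3) ℝ Plane) (q : Fin 3 × ℝ) : Sym2 (Set Plane) :=
  s(chord b q.1 q.2, chord b (q.1 + 1) (1 / (2 * yOf q.2)))

lemma isQuadrisection_chords (T : Affine.Triangle ℝ Plane) (i : Fin 3) {x : ℝ}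
    (hx : x ∈ Ioc (√2 / 2) 1)
    (h : power (foot (triBasis T) i) (ratio (triBasis T) i) x = 0) :
    IsQuadrisection T (chord (triBasis T) i x)
      (chord (triBasis T) (i + 1) (1 / (2 * yOf x))) := by
  set b := triBasis T
  have hx' := mem_Ioc_half hx
  have hy' := yOf_mem_Ico_half hx
  have hz' := inv_two_mul_mem hy'
  have hq : Quarters b (chordFn b i x) (chordFn b (i + 1) (1 / (2 * yOf x))) :=
    (quarters_adjacent_iff b i hx' hy').2 ((area_equation_iff hx' hy').2 ⟨hx.1, rfl⟩)
  have hset : body T \ (chord b i x ∪ chord b (i + 1) (1 / (2 * yOf x))) =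
      {z ∈ hull b | chordFn b i x z ≠ 0 ∧ chordFn b (i + 1) (1 / (2 * yOf x)) z ≠ 0} := by
    rw [chord_eq b i hx', chord_eq b (i + 1) hz', ← hull_triBasis]
    ext z
    simp only [mem_sdiff, mem_union, mem_ofPred_eq]
    tauto
  have hreg := hq.components
  rw [← hset] at hreg
  change regions T _ _ = _ at hreg
  refine ⟨⟨far b i x, far_mem_frontier b i hx', near b i x, near_mem_frontier b i hx',
    far b (i + 1) _, far_mem_frontier b _ hz', near b (i + 1) _, near_mem_frontier b _ hz',
    (near_ne_far b i hx').symm, (near_ne_far b _ hz').symm, rfl, rfl,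
    (inner_chords_eq_zero_iff b i hx).2 h⟩, ?_, ?_⟩
  · rw [hreg, hq.encard_components]
  · rw [hreg]; exact hq.volume_components

lemma adjacent_parameters (b : AffineBasis (Fin 3) ℝ Plane) (i : Fin 3) {x z : ℝ}
    (hx : x ∈ Ioc (1 / 2) 1) (hz : z ∈ Ioc (1 / 2) 1)
    (h : Quarters b (chordFn b i x) (chordFn b (i + 1) z)) :
    x ∈ Ioc (√2 / 2) 1 ∧ z = 1 / (2 * yOf x) := by
  have hz0 : 0 < z := by linarith [hz.1]
  have e : z = 1 / (2 * (1 / (2 * z))) := by field_simp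
  have hy : 1 / (2 * z) ∈ Ico (1 / 2 : ℝ) 1 := by
    constructor
    · rw [div_le_div_iff₀ (by norm_num) (by positivity)]; linarith [hz.2]
    · rw [div_lt_one (by positivity)]; linarith [hz.1]
  rw [e] at h
  obtain ⟨h1, h2⟩ := (area_equation_iff hx hy).1 ((quarters_adjacent_iff b i hx hy).1 h)
  exact ⟨⟨h1, hx.2⟩, by rw [← h2]; exact e⟩

lemma IsQuadrisection.exists_chordPair {T : Affine.Triangle ℝ Plane} {s t : Set Plane}
    (h : IsQuadrisection T s t) : ∃ i, ∃ x ∈ Ioc (√2 / 2) 1,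
      power (foot (triBasis T) i) (ratio (triBasis T) i) x = 0 ∧
      s(s, t) = chordPair (triBasis T) (i, x) := by
  obtain ⟨⟨P, hP, X, hX, Q, hQ, Y, hY, hPX, hQY, rfl, rfl, hperp⟩, -, hvol⟩ := h
  rw [← hull_triBasis] at hP hX hQ hY
  set b := triBasis T
  obtain ⟨f, hfX, hfP, u, hu⟩ := exists_line_fn hPX
  obtain ⟨g, hgY, hgQ, w, hw⟩ := exists_line_fn hQY
  have seg : ∀ {f : Plane →ᵃ[ℝ] ℝ} {X P : Plane}, f X = 0 → f P = 0 →
      ∀ z ∈ segment ℝ X P, f z = 0 := by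
    intro f X P h1 h2
    exact ((convex_singleton (0 : ℝ)).affine_preimage f).segment_subset h1 h2
  have hq : Quarters b f g := Quarters.of_components b hu hw (seg hfX hfP) (seg hgY hgQ)
    fun z hz => hvol _ ⟨z, hz, rfl⟩
  obtain ⟨i, x, hx, c, hc, rfl⟩ := exists_chordFn b f hq.half_eq hq.neg.half_eq
  obtain ⟨j, z, hz, d, hd, rfl⟩ := exists_chordFn b g hq.symm.half_eq hq.symm.neg.half_eq
  have hq := ((hq.of_smul hc).symm.of_smul hd).symm
  have van : ∀ {c : ℝ} {f : Plane →ᵃ[ℝ] ℝ} {X : Plane}, c ≠ 0 → (c • f) X = 0 → f X = 0 := by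
    intro c f X hc h
    exact (mul_eq_zero.1 h).resolve_left hc
  obtain ⟨hs, k, hk, hPX'⟩ := endpoints_of_frontier b i hx (van hc hfX) (van hc hfP) hX hP hPX
  obtain ⟨ht, m, hm, hQY'⟩ := endpoints_of_frontier b j hz (van hd hgY) (van hd hgQ) hY hQ hQY
  rw [hPX', hQY', real_inner_smul_left, real_inner_smul_right] at hperp
  have hperp := (mul_eq_zero.1 ((mul_eq_zero.1 hperp).resolve_left hk)).resolve_left hm
  rw [hs, ht]
  -- In `Fin 3` any two distinct corners are cyclic neighbours, in one order or the other.
  have hij : i = j ∨ j = i + 1 ∨ i = j + 1 := by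
    clear * -
    revert i j; decide
  rcases hij with rfl | rfl | rfl
  · exact absurd hq (not_quarters_same b i hx hz)
  · obtain ⟨hx', rfl⟩ := adjacent_parameters b i hx hz hq
    exact ⟨i, x, hx', (inner_chords_eq_zero_iff b i hx').1 hperp, rfl⟩
  · obtain ⟨hz', rfl⟩ := adjacent_parameters b j hz hx hq.symm
    rw [real_inner_comm] at hperp
    exact ⟨j, z, hz', (inner_chords_eq_zero_iff b j hz').1 hperp, Sym2.eq_swap⟩

lemma chordPair_injOn (b : AffineBasis (Fin 3) ℝ Plane) :
    InjOn (chordPair b) {q | q.2 ∈ Ioc (√2 / 2) 1} := by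
  rintro ⟨i, x⟩ hx ⟨j, x'⟩ hx' h
  have hx : x ∈ Ioc (√2 / 2) 1 := hx
  have hx' : x' ∈ Ioc (√2 / 2) 1 := hx'
  have hz := inv_two_mul_mem (yOf_mem_Ico_half hx)
  have hz' := inv_two_mul_mem (yOf_mem_Ico_half hx')
  rcases Sym2.eq_iff.1 h with ⟨h1, -⟩ | ⟨h1, h2⟩
  · obtain ⟨rfl, rfl⟩ := chord_injective b (mem_Ioc_half hx) (mem_Ioc_half hx') h1
    rfl
  -- A swapped match would give `i = j + 1` and `i + 1 = j`, impossible modulo 3.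
  · have e1 := (chord_injective b (mem_Ioc_half hx) hz' h1).1
    have e2 := (chord_injective b hz (mem_Ioc_half hx') h2).1
    simp only at e1 e2
    exfalso
    clear * - e1 e2
    revert i j; decide

/-- The number of quadrisections is the number of zeros, over the three edges. -/
lemma quads_eq (T : Affine.Triangle ℝ Plane) : quads T =
    (zeros (foot (triBasis T) 0) (ratio (triBasis T) 0) (Ioc (√2 / 2) 1)).encard +
    (zeros (foot (triBasis T) 1) (ratio (triBasis T) 1) (Ioc (√2 / 2) 1)).encard +
    (zeros (foot (triBasis T) 2) (ratio (triBasis T) 2) (Ioc (√2 / 2) 1)).encard := by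
  set b := triBasis T
  let Z : Fin 3 → Set ℝ := fun i => zeros (foot b i) (ratio b i) (Ioc (√2 / 2) 1)
  let A : Fin 3 → Set (Fin 3 × ℝ) := fun i => Prod.mk i '' Z i
  have hA : ∀ i, (A i).encard = (Z i).encard := fun i =>
    (Prod.mk_right_injective i).encard_image _
  have hset : {q : Sym2 (Set Plane) | ∃ s t, q = s(s, t) ∧ IsQuadrisection T s t} =
      chordPair b '' (A 0 ∪ A 1 ∪ A 2) := by
    have hU : ∀ i x, (i, x) ∈ A 0 ∪ A 1 ∪ A 2 ↔ x ∈ Z i := by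
      intro i x
      simp only [A, mem_union, mem_image, Prod.mk.injEq]
      constructor
      · rintro ((⟨z, hz, rfl, rfl⟩ | ⟨z, hz, rfl, rfl⟩) | ⟨z, hz, rfl, rfl⟩) <;> exact hz
      · intro hx
        fin_cases i
        · exact Or.inl (Or.inl ⟨x, hx, rfl, rfl⟩)
        · exact Or.inl (Or.inr ⟨x, hx, rfl, rfl⟩)
        · exact Or.inr ⟨x, hx, rfl, rfl⟩
    ext q
    constructor
    · rintro ⟨s, t, rfl, hq⟩
      obtain ⟨i, x, hx, h0, he⟩ := hq.exists_chordPair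
      exact ⟨(i, x), (hU i x).2 ⟨hx, h0⟩, he.symm⟩
    · rintro ⟨⟨i, x⟩, hq, rfl⟩
      obtain ⟨hx, h0⟩ := (hU i x).1 hq
      exact ⟨_, _, rfl, isQuadrisection_chords T i hx h0⟩
  have hdisj : ∀ i j, i ≠ j → Disjoint (A i) (A j) := by
    intro i j hij
    rw [Set.disjoint_left]
    rintro _ ⟨x, -, rfl⟩ ⟨z, -, h⟩
    exact hij (congrArg Prod.fst h).symm
  rw [quads, hset, ((chordPair_injOn b).mono _).encard_image, encard_union_eq, encard_union_eq,
    hA, hA, hA]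
  · exact hdisj 0 1 (by decide)
  · exact (hdisj 0 2 (by decide)).union_left (hdisj 1 2 (by decide))
  · rintro _ ((⟨x, hx, rfl⟩ | ⟨x, hx, rfl⟩) | ⟨x, hx, rfl⟩) <;> exact hx.1

/-! ### The shape of a triangle -/

/-- The length of the edge opposite to a vertex. -/
def opp (T : Affine.Triangle ℝ Plane) (k : Fin 3) : ℝ := dist (T.points (k + 1)) (T.points (k + 2))

lemma perm_add (σ : Equiv.Perm (Fin 3)) (k : Fin 3) :
    (σ k + 1 = σ (k + 1) ∧ σ k + 2 = σ (k + 2)) ∨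
    (σ k + 1 = σ (k + 2) ∧ σ k + 2 = σ (k + 1)) := by
  revert σ k; decide

lemma opp_perm (T : Affine.Triangle ℝ Plane) (σ : Equiv.Perm (Fin 3)) (k : Fin 3) :
    opp T (σ k) = dist (T.points (σ (k + 1))) (T.points (σ (k + 2))) := by
  unfold opp
  rcases perm_add σ k with ⟨h1, h2⟩ | ⟨h1, h2⟩
  · rw [h1, h2]
  · rw [h1, h2, dist_comm]

lemma dist_plane (a b c d : ℝ) : dist (!₂[a, b] : Plane) !₂[c, d] = √((a - c) ^ 2 + (b - d) ^ 2) := by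
  rw [EuclideanSpace.dist_eq, Fin.sum_univ_two]
  simp [Real.dist_eq]

lemma similar_iff_opp (T : Affine.Triangle ℝ Plane) (σ : Equiv.Perm (Fin 3)) (h t : ℝ) :
    Similar (T.points ∘ σ) ![!₂[0, 0], !₂[1, 0], (!₂[h, t] : Plane)] ↔
      ∃ r > 0, opp T (σ 0) = r * √((h - 1) ^ 2 + t ^ 2) ∧ opp T (σ 1) = r * √(h ^ 2 + t ^ 2) ∧
        opp T (σ 2) = r := by
  rw [similar_iff_exists_pos_dist_eq]
  refine exists_congr fun r => and_congr_right fun _ => ?_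
  have e0 := opp_perm T σ 0
  have e1 := opp_perm T σ 1
  have e2 := opp_perm T σ 2
  rw [e0, e1, e2]
  have f0 : dist (!₂[1, 0] : Plane) !₂[h, t] = √((h - 1) ^ 2 + t ^ 2) := by
    rw [dist_plane]; congr 1; ring
  have f1 : dist (!₂[h, t] : Plane) !₂[0, 0] = √(h ^ 2 + t ^ 2) := by
    rw [dist_plane]; congr 1; ring
  have f2 : dist (!₂[0, 0] : Plane) !₂[1, 0] = 1 := by
    rw [dist_plane]; norm_num
  rw [← f0, ← f1]
  constructor
  · intro H
    refine ⟨H 1 2, H 2 0, ?_⟩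
    have := H 0 1
    simp only [Function.comp_apply, Matrix.cons_val_zero, Matrix.cons_val_one, f2, mul_one] at this
    exact this
  · rintro ⟨h0, h1, h2⟩ i j
    have h2' : dist (T.points (σ 0)) (T.points (σ 1)) = r * dist (!₂[0, 0] : Plane) !₂[1, 0] := by
      rw [f2, mul_one]; exact h2
    have h0' : dist (T.points (σ 2)) (T.points (σ 1)) = r * dist (!₂[h, t] : Plane) !₂[1, 0] := by
      rw [dist_comm, dist_comm _ (!₂[1, 0] : Plane)]; exact h0
    have h1' : dist (T.points (σ 0)) (T.points (σ 2)) = r * dist (!₂[0, 0] : Plane) !₂[h, t] := by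
      rw [dist_comm, dist_comm (!₂[0, 0] : Plane)]; exact h1
    have h2'' : dist (T.points (σ 1)) (T.points (σ 0)) = r * dist (!₂[1, 0] : Plane) !₂[0, 0] := by
      rw [dist_comm, dist_comm (!₂[1, 0] : Plane)]; exact h2'
    fin_cases i <;> fin_cases j
    · simp
    · exact h2'
    · exact h1'
    · exact h2''
    · simp
    · exact h0
    · exact h1
    · exact h0'
    · simp

lemma monotone_fin_three {f : Fin 3 → ℝ} (h0 : f 0 ≤ f 1) (h1 : f 1 ≤ f 2) : Monotone f := by
  rw [Fin.monotone_iff_le_succ]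
  intro i
  fin_cases i
  · exact h0
  · exact h1

/-- The middle length has index 2 in this labelling, hence the transposition of 1 and 2 when
sorting. -/
lemma opp_sorted {T : Affine.Triangle ℝ Plane} {σ : Equiv.Perm (Fin 3)} {h t r : ℝ}
    (hA : 1 ≤ h ^ 2 + t ^ 2) (hB : (h - 1) ^ 2 + t ^ 2 ≤ 1) (hr : 0 < r)
    (h0 : opp T (σ 0) = r * √((h - 1) ^ 2 + t ^ 2)) (h1 : opp T (σ 1) = r * √(h ^ 2 + t ^ 2))
    (h2 : opp T (σ 2) = r) : Monotone (opp T ∘ (Equiv.swap 1 2).trans σ) := by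
  apply monotone_fin_three
  · change opp T (σ (Equiv.swap 1 2 0)) ≤ opp T (σ (Equiv.swap 1 2 1))
    have e0 : Equiv.swap (1 : Fin 3) 2 0 = 0 := by decide
    have e1 : Equiv.swap (1 : Fin 3) 2 1 = 2 := by decide
    rw [e0, e1, h0, h2]
    exact mul_le_of_le_one_right hr.le (Real.sqrt_le_one.2 hB)
  · change opp T (σ (Equiv.swap 1 2 1)) ≤ opp T (σ (Equiv.swap 1 2 2))
    have e1 : Equiv.swap (1 : Fin 3) 2 1 = 2 := by decide
    have e2 : Equiv.swap (1 : Fin 3) 2 2 = 1 := by decide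
    rw [e1, e2, h1, h2]
    exact le_mul_of_one_le_right hr.le (Real.one_le_sqrt.2 hA)

lemma shape_unique {T : Affine.Triangle ℝ Plane} {h t h' t' : ℝ}
    (hC : !₂[h, t] ∈ middleRegion) (hC' : !₂[h', t'] ∈ middleRegion)
    (hS : HasShape T !₂[h, t]) (hS' : HasShape T !₂[h', t']) : h = h' ∧ t = t' := by
  obtain ⟨-, ht, hA, hB⟩ := hC
  obtain ⟨-, ht', hA', hB'⟩ := hC'
  change 0 < t at ht
  change 1 ≤ h ^ 2 + t ^ 2 at hA
  change (h - 1) ^ 2 + t ^ 2 ≤ 1 at hB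
  change 0 < t' at ht'
  change 1 ≤ h' ^ 2 + t' ^ 2 at hA'
  change (h' - 1) ^ 2 + t' ^ 2 ≤ 1 at hB'
  obtain ⟨σ, hσ⟩ := hS
  obtain ⟨τ, hτ⟩ := hS'
  obtain ⟨r, hr, h0, h1, h2⟩ := (similar_iff_opp T σ h t).1 hσ
  obtain ⟨r', hr', h0', h1', h2'⟩ := (similar_iff_opp T τ h' t').1 hτ
  have hm := Tuple.unique_monotone (opp_sorted hA hB hr h0 h1 h2)
    (opp_sorted hA' hB' hr' h0' h1' h2')
  have key : ∀ k, opp T (σ k) = opp T (τ k) := by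
    intro k
    have := congrFun hm (Equiv.swap 1 2 k)
    simpa using this
  have er : r = r' := by rw [← h2, ← h2', key]
  subst er
  have e0 := key 0
  have e1 := key 1
  rw [h0, h0'] at e0
  rw [h1, h1'] at e1
  have e0 := (Real.sqrt_inj (by positivity) (by positivity)).1 (mul_left_cancel₀ hr.ne' e0)
  have e1 := (Real.sqrt_inj (by positivity) (by positivity)).1 (mul_left_cancel₀ hr.ne' e1)
  have eh : h = h' := by linarith
  subst eh
  exact ⟨rfl, by nlinarith⟩

lemma opp_lt_add (T : Affine.Triangle ℝ Plane) (σ : Equiv.Perm (Fin 3)) :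
    opp T (σ 1) < opp T (σ 2) + opp T (σ 0) := by
  rw [opp_perm, opp_perm, opp_perm]
  change dist (T.points (σ 2)) (T.points (σ 0)) <
    dist (T.points (σ 0)) (T.points (σ 1)) + dist (T.points (σ 1)) (T.points (σ 2))
  rw [dist_comm (T.points (σ 2))]
  refine (dist_triangle _ _ _).lt_of_ne fun he => ?_
  have hw := (dist_add_dist_eq_iff.1 he.symm).collinear
  refine (affineIndependent_iff_not_collinear (k := ℝ)).1 T.independent (hw.subset ?_)
  rintro _ ⟨i, rfl⟩
  obtain ⟨k, rfl⟩ := σ.surjective i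
  fin_cases k <;> simp

lemma opp_pos (T : Affine.Triangle ℝ Plane) (k : Fin 3) : 0 < opp T k :=
  dist_pos.2 fun h => (add_one_ne k).2.2 (T.independent.injective h).symm

lemma shape_exists (T : Affine.Triangle ℝ Plane) :
    ∃ C : Plane, C ∈ middleRegion ∧ HasShape T C := by
  have hs := Tuple.monotone_sort (opp T)
  set σ : Equiv.Perm (Fin 3) := (Equiv.swap 1 2).trans (Tuple.sort (opp T)) with hσ
  have s0 : Tuple.sort (opp T) 0 = σ 0 := by
    have : Equiv.swap (1 : Fin 3) 2 0 = 0 := by decide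
    simp [hσ, this]
  have s1 : Tuple.sort (opp T) 1 = σ 2 := by simp [hσ]
  have s2 : Tuple.sort (opp T) 2 = σ 1 := by simp [hσ]
  have l0 : opp T (σ 0) ≤ opp T (σ 2) := by
    rw [← s0, ← s1]; exact hs (by decide : (0 : Fin 3) ≤ 1)
  have l1 : opp T (σ 2) ≤ opp T (σ 1) := by
    rw [← s1, ← s2]; exact hs (by decide : (1 : Fin 3) ≤ 2)
  have hlt := opp_lt_add T σ
  have hc := opp_pos T (σ 2)
  have ha := opp_pos T (σ 0)
  have hb := opp_pos T (σ 1)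
  set c := opp T (σ 2) with hc'
  obtain ⟨α, hα⟩ : ∃ α, opp T (σ 0) = c * α := ⟨opp T (σ 0) / c, by field_simp⟩
  obtain ⟨β, hβ⟩ : ∃ β, opp T (σ 1) = c * β := ⟨opp T (σ 1) / c, by field_simp⟩
  rw [hα] at l0 ha hlt
  rw [hβ] at l1 hb hlt
  have α0 : 0 < α := pos_of_mul_pos_right ha hc.le
  have β0 : 0 < β := pos_of_mul_pos_right hb hc.le
  have α1 : α ≤ 1 := by
    apply le_of_mul_le_mul_left _ hc; linarith
  have β1 : 1 ≤ β := by
    apply le_of_mul_le_mul_left _ hc; linarith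
  have hαβ : β < 1 + α := by
    apply lt_of_mul_lt_mul_left _ hc.le; linarith
  -- The law of cosines, with the middle side scaled to 1.
  set h := (β ^ 2 + 1 - α ^ 2) / 2 with hh
  have ht2 : 0 < β ^ 2 - h ^ 2 := by
    have : β ^ 2 - h ^ 2 = (α - (β - 1)) * (α + (β - 1)) / 2 * (β + h) := by rw [hh]; ring
    have hh0 : 0 < h := by rw [hh]; nlinarith
    rw [this]
    have : 0 < α - (β - 1) := by linarith
    have : 0 < α + (β - 1) := by linarith
    positivity
  have hsq : √(β ^ 2 - h ^ 2) ^ 2 = β ^ 2 - h ^ 2 := Real.sq_sqrt ht2.le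
  have eN : h ^ 2 + √(β ^ 2 - h ^ 2) ^ 2 = β ^ 2 := by rw [hsq]; ring
  have eρ : (h - 1) ^ 2 + √(β ^ 2 - h ^ 2) ^ 2 = α ^ 2 := by rw [hsq, hh]; ring
  refine ⟨!₂[h, √(β ^ 2 - h ^ 2)], ⟨?_, ?_, ?_, ?_⟩, σ, (similar_iff_opp T σ _ _).2
    ⟨c, hc, ?_, ?_, rfl⟩⟩
  · change 1 / 2 ≤ h
    rw [hh]; nlinarith
  · exact Real.sqrt_pos.2 ht2
  · change 1 ≤ h ^ 2 + √(β ^ 2 - h ^ 2) ^ 2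
    rw [eN]; nlinarith
  · change (h - 1) ^ 2 + √(β ^ 2 - h ^ 2) ^ 2 ≤ 1
    rw [eρ]; nlinarith
  · rw [eρ, Real.sqrt_sq α0.le, hα]
  · rw [eN, Real.sqrt_sq β0.le, hβ]

/-! ### From the triangle to its normalized shape. -/

lemma quads_congr {T T' : Affine.Triangle ℝ Plane} (h : body T = body T') : quads T = quads T' := by
  unfold quads IsQuadrisection regions
  rw [h]

lemma foot_eq (b : AffineBasis (Fin 3) ℝ Plane) (i : Fin 3) : foot b i =
    (dist (b (i + 2)) (b i) ^ 2 + dist (b (i + 1)) (b i) ^ 2 -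
      dist (b (i + 2)) (b (i + 1)) ^ 2) / (2 * dist (b (i + 1)) (b i) ^ 2) := by
  rw [foot, real_inner_eq_norm_mul_self_add_norm_mul_self_sub_norm_sub_mul_self_div_two,
    sub_sub_sub_cancel_right, ← dist_eq_norm, ← dist_eq_norm, ← dist_eq_norm, div_div]
  ring

lemma ratio_eq (b : AffineBasis (Fin 3) ℝ Plane) (i : Fin 3) : ratio b i =
    dist (b (i + 2)) (b i) ^ 2 / dist (b (i + 1)) (b i) ^ 2 := by
  rw [ratio, ← dist_eq_norm, ← dist_eq_norm]

lemma quads_eq_total {T : Affine.Triangle ℝ Plane} {h t : ℝ} (ht : 0 < t)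
    (hS : HasShape T !₂[h, t]) : quads T = total h t := by
  obtain ⟨σ, hσ⟩ := hS
  obtain ⟨r, hr, h0, h1, h2⟩ := (similar_iff_opp T σ h t).1 hσ
  have hbody : body T = body (T.reindex σ.symm) := by
    unfold body
    change _ = convexHull ℝ (range (T.points ∘ σ))
    rw [EquivLike.range_comp]
  rw [quads_congr hbody, quads_eq]
  set b := triBasis (T.reindex σ.symm)
  have hb : ∀ k, b k = T.points (σ k) := fun k => rfl
  set ρ := (h - 1) ^ 2 + t ^ 2 with hρ
  set N := h ^ 2 + t ^ 2 with hN
  have hρ0 : 0 < ρ := by positivity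
  have hN0 : 0 < N := by positivity
  have hNρ : N = ρ + 2 * h - 1 := by rw [hN, hρ]; ring
  have d12 : dist (b 1) (b 2) ^ 2 = r ^ 2 * ρ := by
    rw [hb, hb, ← mul_self_sqrt hρ0.le]
    have := opp_perm T σ 0
    rw [h0] at this
    change r * √ρ = dist (T.points (σ 1)) (T.points (σ 2)) at this
    rw [← this]; ring
  have d20 : dist (b 2) (b 0) ^ 2 = r ^ 2 * N := by
    rw [hb, hb, ← mul_self_sqrt hN0.le]
    have := opp_perm T σ 1
    rw [h1] at this
    change r * √N = dist (T.points (σ 2)) (T.points (σ 0)) at this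
    rw [← this]; ring
  have d01 : dist (b 0) (b 1) ^ 2 = r ^ 2 := by
    rw [hb, hb]
    have := opp_perm T σ 2
    rw [h2] at this
    change r = dist (T.points (σ 0)) (T.points (σ 1)) at this
    rw [← this]
  have d21 := d12
  have d02 := d20
  have d10 := d01
  rw [dist_comm] at d21 d02 d10
  have foot0 : foot b 0 = h := by
    rw [foot_eq]
    change (dist (b 2) (b 0) ^ 2 + dist (b 1) (b 0) ^ 2 - dist (b 2) (b 1) ^ 2) /
      (2 * dist (b 1) (b 0) ^ 2) = _
    rw [d20, d10, d21, hNρ]; field_simp; ring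
  -- Read backwards, the edges 1 and 2 place the third vertex at the inverses of `C` about the unit
  -- circles at `(1,0)` and at the origin.
  have foot1 : 1 - foot b 1 = 1 + (h - 1) / ρ := by
    rw [foot_eq]
    change 1 - (dist (b 0) (b 1) ^ 2 + dist (b 2) (b 1) ^ 2 - dist (b 0) (b 2) ^ 2) /
      (2 * dist (b 2) (b 1) ^ 2) = _
    rw [d02, d01, d21, hNρ]; field_simp; ring
  have foot2 : 1 - foot b 2 = h / N := by
    rw [foot_eq]
    change 1 - (dist (b 1) (b 2) ^ 2 + dist (b 0) (b 2) ^ 2 - dist (b 1) (b 0) ^ 2) /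
      (2 * dist (b 0) (b 2) ^ 2) = _
    rw [d02, d10, d12]; field_simp; linarith
  have ratio0 : ratio b 0 = N := by
    rw [ratio_eq]
    change dist (b 2) (b 0) ^ 2 / dist (b 1) (b 0) ^ 2 = _
    rw [d20, d10]; field_simp
  have ratio1 : ratio b 1 + 1 - 2 * foot b 1 = N / ρ := by
    have e : foot b 1 = 1 - (1 + (h - 1) / ρ) := by linarith
    rw [ratio_eq, e]
    change dist (b 0) (b 1) ^ 2 / dist (b 2) (b 1) ^ 2 + 1 - _ = _
    rw [d01, d21, hNρ]; field_simp; ring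
  have ratio2 : ratio b 2 + 1 - 2 * foot b 2 = 1 / N := by
    have e : foot b 2 = 1 - h / N := by linarith
    rw [ratio_eq, e]
    change dist (b 1) (b 2) ^ 2 / dist (b 0) (b 2) ^ 2 + 1 - _ = _
    rw [d12, d02]; field_simp; linarith
  rw [encard_zeros_swap (foot b 1), encard_zeros_swap (foot b 2), foot0, foot1, foot2, ratio0,
    ratio1, ratio2, total]

lemma inversion_coords (h t : ℝ) :
    EuclideanGeometry.inversion (!₂[1, 0] : Plane) 1 !₂[h, t] =
      !₂[1 + (h - 1) / ((h - 1) ^ 2 + t ^ 2), t / ((h - 1) ^ 2 + t ^ 2)] := by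
  rw [EuclideanGeometry.inversion, dist_plane, div_pow, Real.sq_sqrt (by positivity)]
  ext j
  fin_cases j
  · simp; ring
  · simp; ring

end Quadrisection

end

theorem theorem3 (T : Affine.Triangle ℝ Quadrisection.Plane) :
    (∃! C : Quadrisection.Plane, C ∈ Quadrisection.middleRegion ∧ Quadrisection.HasShape T C) ∧
    ∀ C C' : Quadrisection.Plane,
      C ∈ Quadrisection.middleRegion → Quadrisection.HasShape T C →
      C' = EuclideanGeometry.inversion !₂[1, 0] 1 C →
      (C' ∈ Quadrisection.F '' Quadrisection.D2 \ Quadrisection.F '' Quadrisection.J0 →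
        Quadrisection.quads T = 3) ∧
      (C' ∈ Quadrisection.F '' Quadrisection.J0 ∧ C' ≠ Quadrisection.I1 →
        Quadrisection.quads T = 2) ∧
      (C' ∉ Quadrisection.F '' Quadrisection.D2 ∨ C' = Quadrisection.I1 →
        Quadrisection.quads T = 1) := by
  have coords : ∀ C : Quadrisection.Plane, C = !₂[C 0, C 1] := by
    intro C
    ext j
    fin_cases j <;> rfl
  constructor
  · obtain ⟨C, hC, hS⟩ := Quadrisection.shape_exists T
    refine ⟨C, ⟨hC, hS⟩, ?_⟩
    rintro C' ⟨hC', hS'⟩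
    rw [coords C] at hC hS ⊢
    rw [coords C'] at hC' hS' ⊢
    obtain ⟨h1, h2⟩ := Quadrisection.shape_unique hC' hC hS' hS
    rw [h1, h2]
  · rintro C C' hC hS rfl
    obtain ⟨hh, ht, hA, hB⟩ := hC
    rw [coords C] at hS
    rw [Quadrisection.quads_eq_total ht hS, coords C, Quadrisection.inversion_coords]
    exact Quadrisection.total_cases hh ht hA hB rfl rfl
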